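/- Let $G$ be a compact (real, finite-dimensional) Lie group with Lie algebra $\mathfrak g$, let $V$ be a finite-dimensional real vector space and let $\rho:G\to \mathrm{GL}(V)$ be a smooth representation; write $\rho$ also for the infinitesimal representation of $\mathfrak g$. Let $G_\rho=G\times_\rho V$ be the semi-direct product, i.e. the Lie group with underlying manifold $G\times V$ and product $(g,v)(h,w)=(gh,\,v+\rho(g)w)$, and let $\mathfrak g_\rho=\mathfrak g\times V$ be its Lie algebra. Then $V$ admits a $G$-invariant inner product. Fix any $G$-invariant inner product $\langle\cdot,\cdot\rangle$ on $V$. For $w,v\in V$ let $\mu_w(v)\in\mathfrak g^*$ be given by $\mu_w(v)(X)=\langle\rho(X)w,v\rangle$, so that $\mu_w:V\to\mathfrak g^*$ is linear. For $w\in V$ and $\alpha\in\mathfrak g^*$ let $w+\alpha\in\mathfrak g_\rho^*$ be the functional $(X,u)\mapsto \alpha(X)+\langle w,u\rangle$; in this way $V\subset\mathfrak g_\rho^*$. Let $x\in V$. The orbit $\rho(G)x\subset V$ and the coadjoint orbit $\mathcal O=\mathrm{Ad}^*_\rho(G_\rho)\cdot x\subset\mathfrak g_\rho^*$ are embedded submanifolds.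 For every $w\in\rho(G)x$ the affine subspace $w+\mu_w(V)$ is contained in $\mathcal O$, and there is a diffeomorphism $$\phi:\mathcal O\to T^*(\rho(G)x)\quad\text{with}\quad \phi\bigl(w+\mu_w(V)\bigr)=T^*_w(\rho(G)x)\qquad(w\in\rho(G)x),$$ whose restriction to each fiber $w+\mu_w(V)$ is given by a linear isomorphism $\mu_w(V)\to T_w^*(\rho(G)x)$, namely $\phi(w+\mu_w(v))=\langle v,\cdot\rangle|_{T_w(\rho(G)x)}$ for $v\in V$. Moreover, $\phi^*\omega=\Omega$, where $\omega=-d\theta$ is the canonical symplectic form of $T^*(\rho(G)x)$ ($\theta$ the tautological 1-form, so that $\omega=\sum_i dq_i\wedge dp_i$ in cotangent coordinates) and $\Omega$ is the Kostant–Kirillov–Souriau form of $\mathcal O$, given by $\Omega_\xi(\mathrm{ad}^*(X)\xi,\mathrm{ad}^*(Y)\xi)=\xi([X,Y])$ for $\xi\in\mathcal O$ and $X,Y\in\mathfrak g_\rho$, with $\mathrm{ad}^*(X)\xi=-\xi\circ\mathrm{ad}(X)$. -/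

import Mathlib

open scoped Manifold ContDiff

noncomputable section

namespace SemidirectOrbit

/-! ### Coadjoint orbits of a Lie group and the Kostant–Kirillov–Souriau form -/

section Coadjoint

variable {F : Type*} [NormedAddCommGroup F] [NormedSpace ℝ F]
  {H : Type*} [TopologicalSpace H] (J : ModelWithCorners ℝ F H)
  {L : Type*} [TopologicalSpace L] [ChartedSpace H L] [Group L]

/-- The dual `𝔩*` of the Lie algebra `𝔩 = T₁L` of a Lie group `L`. In Mathlib the tangent space
`T₁L` is by definition the model vector space `F`, which provides the norm on `𝔩*`. -/
@[nolint unusedArguments]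
abbrev DualLieAlgebra (_J : ModelWithCorners ℝ F H) (L : Type*) [TopologicalSpace L]
    [ChartedSpace H L] [Group L] : Type _ := F →L[ℝ] ℝ

/-- The adjoint representation: `Ad h` is the differential at `1` of `k ↦ h k h⁻¹`. -/
def Ad (h : L) : GroupLieAlgebra J L →L[ℝ] GroupLieAlgebra J L :=
  mfderiv J J (fun k : L => h * k * h⁻¹) 1

/-- The coadjoint representation: `Ad* h ξ = ξ ∘ Ad h⁻¹`. -/
def coAd (h : L) (ξ : DualLieAlgebra J L) : DualLieAlgebra J L :=
  ContinuousLinearMap.comp (ξ : GroupLieAlgebra J L →L[ℝ] ℝ) (Ad J h⁻¹)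

variable (L) in
/-- The coadjoint orbit of `ξ`. -/
def coadjointOrbit (ξ : DualLieAlgebra J L) : Set (DualLieAlgebra J L) :=
  Set.range fun h : L => coAd J h ξ

variable {J} in
/-- `η = ad*(X) ξ`, that is, `η = -ξ ∘ ad X`. -/
def IsCoad (X : GroupLieAlgebra J L) (ξ η : DualLieAlgebra J L) : Prop :=
  ∀ Z : GroupLieAlgebra J L, η Z = -ξ (⁅X, Z⁆ : GroupLieAlgebra J L)

/-- The inclusion `T_p O → W`: the differential of `O ⊆ W` for a manifold structure on `O`. -/
def tangentIncl {W : Type*} [NormedAddCommGroup W] [NormedSpace ℝ W] (O : Set W)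
    {F' : Type*} [NormedAddCommGroup F'] [NormedSpace ℝ F']
    {H' : Type*} [TopologicalSpace H'] (J' : ModelWithCorners ℝ F' H') [ChartedSpace H' O]
    (p : O) : TangentSpace J' p →L[ℝ] W :=
  mfderiv J' 𝓘(ℝ, W) (Subtype.val : O → W) p

variable (L) in
open Classical in
/-- The Kostant–Kirillov–Souriau form on a coadjoint orbit `O ⊆ 𝔩*`:
`Ω_ξ(ad*(X) ξ, ad*(Y) ξ) = ξ([X, Y])`. (The tangent vectors of a coadjoint orbit at `ξ` are the
`ad*(X) ξ`; the value does not depend on the choice of `X` and `Y`, see `kksForm_eq`.) -/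
def kksForm (O : Set (DualLieAlgebra J L))
    {F' : Type*} [NormedAddCommGroup F'] [NormedSpace ℝ F']
    {H' : Type*} [TopologicalSpace H'] (J' : ModelWithCorners ℝ F' H') [ChartedSpace H' O]
    (ξ : O) (a b : TangentSpace J' ξ) : ℝ :=
  if h : (∃ X : GroupLieAlgebra J L, IsCoad X ξ.1 (tangentIncl O J' ξ a)) ∧
      (∃ Y : GroupLieAlgebra J L, IsCoad Y ξ.1 (tangentIncl O J' ξ b)) then
    ξ.1 (⁅h.1.choose, h.2.choose⁆ : GroupLieAlgebra J L)
  else 0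

variable (L) in
theorem kksForm_eq (O : Set (DualLieAlgebra J L))
    {F' : Type*} [NormedAddCommGroup F'] [NormedSpace ℝ F']
    {H' : Type*} [TopologicalSpace H'] (J' : ModelWithCorners ℝ F' H') [ChartedSpace H' O]
    (ξ : O) (a b : TangentSpace J' ξ) (X Y : GroupLieAlgebra J L)
    (hX : IsCoad X ξ.1 (tangentIncl O J' ξ a)) (hY : IsCoad Y ξ.1 (tangentIncl O J' ξ b)) :
    kksForm J L O J' ξ a b = ξ.1 (⁅X, Y⁆ : GroupLieAlgebra J L) := by
  have h : (∃ X : GroupLieAlgebra J L, IsCoad X ξ.1 (tangentIncl O J' ξ a)) ∧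
      (∃ Y : GroupLieAlgebra J L, IsCoad Y ξ.1 (tangentIncl O J' ξ b)) := ⟨⟨X, hX⟩, ⟨Y, hY⟩⟩
  have skew : ∀ U Z : GroupLieAlgebra J L, ξ.1 (⁅U, Z⁆ : GroupLieAlgebra J L) =
      -ξ.1 (⁅Z, U⁆ : GroupLieAlgebra J L) := by
    intro U Z
    rw [GroupLieAlgebra.bracket_def, VectorField.mlieBracket_swap_apply,
      ← GroupLieAlgebra.bracket_def]
    exact map_neg ξ.1 _
  have e1 := (h.1.choose_spec h.2.choose).symm.trans (hX h.2.choose)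
  have e2 := (h.2.choose_spec X).symm.trans (hY X)
  rw [kksForm, dif_pos h]
  linarith [skew X h.2.choose, skew X Y]

end Coadjoint

/-! ### The cotangent bundle and its canonical symplectic form -/

section Cotangent

variable {E : Type*} [NormedAddCommGroup E] [NormedSpace ℝ E]
  {H : Type*} [TopologicalSpace H] (I : ModelWithCorners ℝ E H)
  (M : Type*) [TopologicalSpace M] [ChartedSpace H M]

/-- The exterior derivative of a 1-form `α` on a manifold without boundary, computed in the
preferred chart at `p`: `dα(a, b) = D_a α̂ (b) - D_b α̂ (a)`, where `α̂` is `α` read in the chart. -/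
def extDerivOneForm [I.Boundaryless] {M : Type*} [TopologicalSpace M] [ChartedSpace H M]
    (α : ∀ p : M, TangentSpace I p →L[ℝ] ℝ) (p : M) (a b : TangentSpace I p) : ℝ :=
  let e := extChartAt I p
  let αhat : E → (E →L[ℝ] ℝ) := fun y => (α (e.symm y)).comp (mfderiv 𝓘(ℝ, E) I e.symm y)
  let a' : E := mfderiv I 𝓘(ℝ, E) e p a
  let b' : E := mfderiv I 𝓘(ℝ, E) e p b
  fderiv ℝ αhat (e p) a' b' - fderiv ℝ αhat (e p) b' a'

variable [IsManifold I 1 M]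

/-- The cotangent bundle `T*M`, as the total space of the bundle dual to the tangent bundle, with
the manifold structure it carries as such. -/
abbrev CotangentBundle : Type _ :=
  Bundle.TotalSpace (E →L[ℝ] ℝ)
    (fun p : M => TangentSpace I p →L[ℝ] Bundle.Trivial M ℝ p)

/-- The model of the cotangent bundle. -/
abbrev cotangentModel : ModelWithCorners ℝ (E × (E →L[ℝ] ℝ)) (ModelProd H (E →L[ℝ] ℝ)) :=
  I.prod 𝓘(ℝ, E →L[ℝ] ℝ)

/-- The tautological 1-form `θ_γ = γ ∘ dπ_γ` on `T*M`, where `π : T*M → M` is the projection. -/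
def tautologicalForm (γ : CotangentBundle I M) :
    TangentSpace (cotangentModel I) γ →L[ℝ] ℝ :=
  ContinuousLinearMap.comp (γ.snd : TangentSpace I γ.proj →L[ℝ] ℝ)
    (mfderiv (cotangentModel I) I (fun γ' : CotangentBundle I M => γ'.proj) γ)

/-- The canonical symplectic form `ω = -dθ` on `T*M`; it is `∑ dqᵢ ∧ dpᵢ` in cotangent
coordinates. -/
def canonicalForm [I.Boundaryless] (γ : CotangentBundle I M)
    (a b : TangentSpace (cotangentModel I) γ) : ℝ :=
  -extDerivOneForm (cotangentModel I) (tautologicalForm I M) γ a b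

end Cotangent

/-! ### Representations and semi-direct products -/

section Semidirect

variable {E : Type*} [NormedAddCommGroup E] [NormedSpace ℝ E]
  {G : Type*} [Group G]
  {V : Type*} [NormedAddCommGroup V] [NormedSpace ℝ V]

/-- The semi-direct product `G ×_ρ V` of a Lie group `G` and the vector group `V`. Its underlying
manifold is the product `G × V`. -/
def SemidirectGroup (_ρ : G →* (V →L[ℝ] V)) : Type _ := G × V

namespace SemidirectGroup

variable (ρ : G →* (V →L[ℝ] V))

/-- `(g, v) (h, w) = (g h, v + ρ(g) w)`. -/
instance : Group (SemidirectGroup ρ) where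
  mul a b := (a.1 * b.1, a.2 + ρ a.1 b.2)
  one := ((1 : G), (0 : V))
  inv a := (a.1⁻¹, -ρ a.1⁻¹ a.2)
  mul_assoc a b c := by
    refine Prod.ext (mul_assoc _ _ _) ?_
    change a.2 + ρ a.1 b.2 + ρ (a.1 * b.1) c.2 = a.2 + ρ a.1 (b.2 + ρ b.1 c.2)
    simp [add_assoc]
  one_mul a := by
    refine Prod.ext (one_mul _) ?_
    change 0 + ρ 1 a.2 = a.2
    simp
  mul_one a := by
    refine Prod.ext (mul_one _) ?_
    change a.2 + ρ a.1 0 = a.2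
    simp
  inv_mul_cancel a := by
    refine Prod.ext (inv_mul_cancel _) ?_
    change -ρ a.1⁻¹ a.2 + ρ a.1⁻¹ a.2 = 0
    simp

variable [TopologicalSpace G] [ChartedSpace E G]

instance : TopologicalSpace (SemidirectGroup ρ) := inferInstanceAs (TopologicalSpace (G × V))

instance : ChartedSpace (ModelProd E V) (SemidirectGroup ρ) :=
  inferInstanceAs (ChartedSpace (ModelProd E V) (G × V))

/-- The component in `G` of an element of `G ×_ρ V`. -/
def toG (a : SemidirectGroup ρ) : G := a.1

/-- The component in `V` of an element of `G ×_ρ V`. -/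
def toV (a : SemidirectGroup ρ) : V := a.2

/-- If the representation is smooth, then `G ×_ρ V` is a Lie group. -/
theorem lieGroup [LieGroup 𝓘(ℝ, E) ∞ G] (hρ : ContMDiff 𝓘(ℝ, E) 𝓘(ℝ, V →L[ℝ] V) ∞ ρ) :
    LieGroup (𝓘(ℝ, E).prod 𝓘(ℝ, V)) ∞ (SemidirectGroup ρ) := by
  have hman : IsManifold (𝓘(ℝ, E).prod 𝓘(ℝ, V)) ∞ (SemidirectGroup ρ) :=
    inferInstanceAs (IsManifold (𝓘(ℝ, E).prod 𝓘(ℝ, V)) ∞ (G × V))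
  have hmul : ContMDiff ((𝓘(ℝ, E).prod 𝓘(ℝ, V)).prod (𝓘(ℝ, E).prod 𝓘(ℝ, V)))
      (𝓘(ℝ, E).prod 𝓘(ℝ, V)) ∞
      (fun p : (G × V) × (G × V) => (p.1.1 * p.2.1, p.1.2 + ρ p.1.1 p.2.2)) := by
    refine (((contMDiff_fst.comp contMDiff_fst).mul (contMDiff_fst.comp contMDiff_snd)).prodMk
      ((contMDiff_snd.comp contMDiff_fst).add ?_))
    exact (hρ.comp (contMDiff_fst.comp contMDiff_fst)).clm_apply
      (contMDiff_snd.comp contMDiff_snd)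
  have hinv : ContMDiff (𝓘(ℝ, E).prod 𝓘(ℝ, V)) (𝓘(ℝ, E).prod 𝓘(ℝ, V)) ∞
      (fun p : G × V => (p.1⁻¹, -ρ p.1⁻¹ p.2)) := by
    refine (contMDiff_fst.inv).prodMk ?_
    exact ((hρ.comp contMDiff_fst.inv).clm_apply contMDiff_snd).neg
  exact { hman with contMDiff_mul := hmul, contMDiff_inv := hinv }

end SemidirectGroup

variable [TopologicalSpace G] [ChartedSpace E G] (ρ : G →* (V →L[ℝ] V))

/-- The model of the semi-direct product `G ×_ρ V`. -/
abbrev semidirectModel (E V : Type*) [NormedAddCommGroup E] [NormedSpace ℝ E]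
    [NormedAddCommGroup V] [NormedSpace ℝ V] : ModelWithCorners ℝ (E × V) (ModelProd E V) :=
  𝓘(ℝ, E).prod 𝓘(ℝ, V)

/-- The projection `𝔤_ρ = 𝔤 × V → 𝔤`. -/
def projG : GroupLieAlgebra (semidirectModel E V) (SemidirectGroup ρ) →L[ℝ]
    GroupLieAlgebra 𝓘(ℝ, E) G :=
  mfderiv (semidirectModel E V) 𝓘(ℝ, E) (SemidirectGroup.toG ρ) 1

/-- The projection `𝔤_ρ = 𝔤 × V → V`. -/
def projV : GroupLieAlgebra (semidirectModel E V) (SemidirectGroup ρ) →L[ℝ] V :=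
  mfderiv (semidirectModel E V) 𝓘(ℝ, V) (SemidirectGroup.toV ρ) 1

/-- `B` is a `G`-invariant inner product on `V`. -/
structure IsInvariantInner (ρ : G →* (V →L[ℝ] V)) (B : V →L[ℝ] V →L[ℝ] ℝ) : Prop where
  symm : ∀ v w, B v w = B w v
  pos : ∀ v, v ≠ 0 → 0 < B v v
  invariant : ∀ g v w, B (ρ g v) (ρ g w) = B v w

/-- The infinitesimal representation: `infRep ρ v X = ρ(X) v = d/dt ρ(exp tX) v` at `t = 0`. -/
def infRep (v : V) : GroupLieAlgebra 𝓘(ℝ, E) G →L[ℝ] V :=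
  mfderiv 𝓘(ℝ, E) 𝓘(ℝ, V) (fun g : G => ρ g v) 1

/-- The moment map `μ_w : V → 𝔤*`, `μ_w(v)(X) = μ(w ⊗ v)(X) = ⟨ρ(X) w, v⟩`. -/
def momentMap (B : V →L[ℝ] V →L[ℝ] ℝ) (w : V) :
    V →ₗ[ℝ] (GroupLieAlgebra 𝓘(ℝ, E) G →L[ℝ] ℝ) where
  toFun v := (B.flip v).comp (infRep ρ w)
  map_add' v v' := by rw [map_add, ContinuousLinearMap.add_comp]
  map_smul' c v := by rw [map_smul, ContinuousLinearMap.smul_comp, RingHom.id_apply]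

/-- The element `w + α` of `𝔤_ρ* = 𝔤* ⊕ V*`, for `α ∈ 𝔤*` and `w ∈ V`, where `V` is identified
with `V*` by the inner product: `(w + α)(X, u) = α(X) + ⟨w, u⟩`. -/
def dualPoint (B : V →L[ℝ] V →L[ℝ] ℝ) (w : V) (α : GroupLieAlgebra 𝓘(ℝ, E) G →L[ℝ] ℝ) :
    DualLieAlgebra (semidirectModel E V) (SemidirectGroup ρ) :=
  (α.comp (projG ρ) + (B w).comp (projV ρ) :
    GroupLieAlgebra (semidirectModel E V) (SemidirectGroup ρ) →L[ℝ] ℝ)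

/-- The orbit `ρ(G) x`. -/
def repOrbit (x : V) : Set V := Set.range fun g : G => ρ g x

variable (E) in
/-- The coadjoint orbit `Ad*_ρ(G_ρ) x` of `x ∈ V ⊆ 𝔤_ρ*`. -/
def semidirectOrbit (B : V →L[ℝ] V →L[ℝ] ℝ) (x : V) :
    Set (DualLieAlgebra (semidirectModel E V) (SemidirectGroup ρ)) :=
  coadjointOrbit (semidirectModel E V) (SemidirectGroup ρ) (dualPoint ρ B x 0)

/-- The affine subspace `w + μ_w(V)` of `𝔤_ρ*`. -/
def orbitFiber (B : V →L[ℝ] V →L[ℝ] ℝ) (w : V) :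
    Set (DualLieAlgebra (semidirectModel E V) (SemidirectGroup ρ)) :=
  dualPoint ρ B w '' (LinearMap.range (momentMap (E := E) ρ B w) : Set _)

end Semidirect

end SemidirectOrbit

end

/-!
An invariant inner product is obtained by averaging any inner product over Haar measure. Computing
`Ad*` at `(g, v)` gives `w + μ_w(v')` with `w = ρ(g) x` and `v'` arbitrary, so the coadjoint orbit
of `x` is the union of the affine spaces `w + μ_w(V)` over `w ∈ ρ(G) x`.

The orbit map `g ↦ ρ(g) x` has constant rank, and by compactness of `G` it is open onto its image
with the subspace topology; hence near each of its points the orbit is the graph of a smooth map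
over an open subset of a vector space. As `μ_w(v)(X) = ⟨ρ(X) w, v⟩`, the kernel of `μ_w` is the
orthogonal complement of `T_w(ρ(G) x)`, which makes `w + μ_w(v) ↦ ⟨v, ·⟩` a well-defined bijection
onto the cotangent bundle. Its inverse sends a covector `γ` at `w` to the functional
`(X, u) ↦ γ(ρ(X) w) + ⟨w, u⟩`, which is manifestly smooth. Smoothness of the bijection itself, and
embeddedness of the coadjoint orbit, follow by restricting functionals to a fixed subspace of `𝔤`
whose image under `X ↦ ρ(X) w` frames the tangent spaces of `ρ(G) x` near a given point.

In cotangent coordinates `(q, p)`, every tangent vector `(q̇, ṗ)` at `ξ` is `ad*(X) ξ` for an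
explicit `X`, and `ξ([X, X'])` evaluates to `ṗ' q̇ - ṗ q̇'`, which is `∑ dqᵢ ∧ dpᵢ`.
-/

open scoped Manifold ContDiff Topology

noncomputable section

namespace SemidirectOrbit

/-! ### Sets that are locally graphs -/

section GraphChart

variable {A : Type*} [NormedAddCommGroup A] [NormedSpace ℝ A]
  {W : Type*} [NormedAddCommGroup W] [NormedSpace ℝ W] {S : Set W}

/-- A presentation of an open piece `S ∩ dom` of `S ⊆ W` as the image of a smooth section `sec`,
defined on an open set of `A`, of a linear map `proj : W → A`. Choosing a complement of `A` in `W`,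
this presents `S ∩ dom` as the graph of a smooth map. -/
structure GraphChart (A : Type*) [NormedAddCommGroup A] [NormedSpace ℝ A]
    {W : Type*} [NormedAddCommGroup W] [NormedSpace ℝ W] (S : Set W) where
  dom : Set W
  param : Set A
  proj : W →L[ℝ] A
  sec : A → W
  isOpen_dom : IsOpen dom
  isOpen_param : IsOpen param
  contDiffOn_sec : ContDiffOn ℝ ∞ sec param
  image_sec : sec '' param = S ∩ dom
  proj_sec : Set.LeftInvOn proj sec param

namespace GraphChart

theorem sec_mem (c : GraphChart A S) {t : A} (ht : t ∈ c.param) : c.sec t ∈ S :=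
  (c.image_sec.subset ⟨t, ht, rfl⟩).1

theorem sec_mem_dom (c : GraphChart A S) {t : A} (ht : t ∈ c.param) : c.sec t ∈ c.dom :=
  (c.image_sec.subset ⟨t, ht, rfl⟩).2

theorem proj_mem_param (c : GraphChart A S) {s : W} (hs : s ∈ S) (hsc : s ∈ c.dom) :
    c.proj s ∈ c.param := by
  obtain ⟨t, ht, rfl⟩ := c.image_sec.superset ⟨hs, hsc⟩
  rwa [c.proj_sec ht]

theorem sec_proj (c : GraphChart A S) {s : W} (hs : s ∈ S) (hsc : s ∈ c.dom) :
    c.sec (c.proj s) = s := by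
  obtain ⟨t, ht, rfl⟩ := c.image_sec.superset ⟨hs, hsc⟩
  rw [c.proj_sec ht]

/-- The same graph, as a chart of another set that agrees with it on open sets. -/
def ofInterEq {S' : Set W} (c : GraphChart A S) {U : Set W} (hU : IsOpen U)
    (h : S ∩ c.dom = S' ∩ U) : GraphChart A S' where
  __ := c
  dom := U
  isOpen_dom := hU
  image_sec := c.image_sec.trans h

/-- The image of a graph chart under a linear automorphism that preserves the set. -/
def map (c : GraphChart A S) (T : W ≃L[ℝ] W) (hT : ∀ s, T s ∈ S ↔ s ∈ S) : GraphChart A S where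
  dom := T.symm ⁻¹' c.dom
  param := c.param
  proj := c.proj.comp (T.symm : W →L[ℝ] W)
  sec t := T (c.sec t)
  isOpen_dom := c.isOpen_dom.preimage T.symm.continuous
  isOpen_param := c.isOpen_param
  contDiffOn_sec := T.contDiff.comp_contDiffOn c.contDiffOn_sec
  image_sec := by
    rw [← Function.comp_def, Set.image_comp, c.image_sec, T.image_eq_preimage_symm,
      Set.preimage_inter]
    congr 1
    ext s
    rw [Set.mem_preimage, ← hT, T.apply_symm_apply]
  proj_sec t ht := by simpa using c.proj_sec ht

/-- Reparametrization of a graph chart by a linear isomorphism. -/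
def reparam {A' : Type*} [NormedAddCommGroup A'] [NormedSpace ℝ A']
    (c : GraphChart A S) (e : A ≃L[ℝ] A') : GraphChart A' S where
  dom := c.dom
  param := e.symm ⁻¹' c.param
  proj := (e : A →L[ℝ] A').comp c.proj
  sec t := c.sec (e.symm t)
  isOpen_dom := c.isOpen_dom
  isOpen_param := c.isOpen_param.preimage e.symm.continuous
  contDiffOn_sec := c.contDiffOn_sec.comp e.symm.contDiff.contDiffOn fun _ ht => ht
  image_sec := by
    rw [← c.image_sec, ← Function.comp_def, Set.image_comp,
      Set.image_preimage_eq _ e.symm.surjective]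
  proj_sec t ht := by simp [c.proj_sec ht]

theorem hasFDerivAt_sec (c : GraphChart A S) {t : A} (ht : t ∈ c.param) :
    HasFDerivAt c.sec (fderiv ℝ c.sec t) t :=
  ((c.contDiffOn_sec.contDiffAt (c.isOpen_param.mem_nhds ht)).differentiableAt
    (by simp)).hasFDerivAt

theorem proj_fderiv_sec (c : GraphChart A S) {t : A} (ht : t ∈ c.param) :
    Function.RightInverse (fderiv ℝ c.sec t) c.proj := by
  have hproj_sec : c.proj ∘ c.sec =ᶠ[𝓝 t] id :=
    Filter.eventuallyEq_of_mem (c.isOpen_param.mem_nhds ht) fun _ hy => c.proj_sec hy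
  have hderiv : c.proj.comp (fderiv ℝ c.sec t) = ContinuousLinearMap.id ℝ A :=
    (c.proj.hasFDerivAt.comp t (c.hasFDerivAt_sec ht)).unique
      ((hasFDerivAt_id t).congr_of_eventuallyEq hproj_sec)
  exact DFunLike.congr_fun hderiv

open Classical in
/-- The chart of `S` attached to a local presentation of `S` as a graph. Outside `param` the
inverse takes the junk value `s₀`. -/
def toChart (c : GraphChart A S) (s₀ : S) : OpenPartialHomeomorph S A where
  toFun s := c.proj s.1
  invFun t := if ht : t ∈ c.param then ⟨c.sec t, c.sec_mem ht⟩ else s₀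
  source := Subtype.val ⁻¹' c.dom
  target := c.param
  map_source' s hs := c.proj_mem_param s.2 hs
  map_target' t ht := by simpa only [dif_pos ht, Set.mem_preimage] using c.sec_mem_dom ht
  left_inv' s hs := by
    simpa only [dif_pos (c.proj_mem_param s.2 hs)] using Subtype.ext (c.sec_proj s.2 hs)
  right_inv' t ht := by simpa only [dif_pos ht] using c.proj_sec ht
  open_source := c.isOpen_dom.preimage continuous_subtype_val
  open_target := c.isOpen_param
  continuousOn_toFun := (c.proj.continuous.comp continuous_subtype_val).continuousOn
  continuousOn_invFun := by
    rw [Topology.IsEmbedding.subtypeVal.continuousOn_iff]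
    refine c.contDiffOn_sec.continuousOn.congr fun t ht => ?_
    simp [dif_pos ht]

@[simp] theorem toChart_apply (c : GraphChart A S) (s₀ s : S) :
    c.toChart s₀ s = c.proj s.1 := rfl

@[simp] theorem toChart_source (c : GraphChart A S) (s₀ : S) :
    (c.toChart s₀).source = Subtype.val ⁻¹' c.dom := rfl

@[simp] theorem toChart_target (c : GraphChart A S) (s₀ : S) :
    (c.toChart s₀).target = c.param := rfl

theorem toChart_symm_apply (c : GraphChart A S) (s₀ : S) {t : A} (ht : t ∈ c.param) :
    ((c.toChart s₀).symm t).1 = c.sec t := by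
  simp [toChart, ht]

/-- The diffeomorphism `v ↦ v - sec (proj v) + R (proj v)` of `proj ⁻¹ param`, where `R` is a
linear section of `proj`: it moves the graph of `sec` onto the linear subspace `range R`. -/
def shear (c : GraphChart A S) (R : A →L[ℝ] W) (hR : Function.RightInverse R c.proj) :
    OpenPartialHomeomorph W W :=
  have hsec : ContinuousOn (fun v => c.sec (c.proj v)) (c.proj ⁻¹' c.param) :=
    c.contDiffOn_sec.continuousOn.comp c.proj.continuous.continuousOn fun _ hv => hv
  have hlin : ContinuousOn (fun v => R (c.proj v)) (c.proj ⁻¹' c.param) :=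
    (R.continuous.comp c.proj.continuous).continuousOn
  { toFun := fun v => v - c.sec (c.proj v) + R (c.proj v)
    invFun := fun v => v - R (c.proj v) + c.sec (c.proj v)
    source := c.proj ⁻¹' c.param
    target := c.proj ⁻¹' c.param
    map_source' := fun v hv => by simpa [hR _, c.proj_sec hv] using hv
    map_target' := fun v hv => by simpa [hR _, c.proj_sec hv] using hv
    left_inv' := fun v hv => by simp [hR _, c.proj_sec hv]
    right_inv' := fun v hv => by simp [hR _, c.proj_sec hv]
    open_source := c.isOpen_param.preimage c.proj.continuous
    open_target := c.isOpen_param.preimage c.proj.continuous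
    continuousOn_toFun := (continuousOn_id.sub hsec).add hlin
    continuousOn_invFun := (continuousOn_id.sub hlin).add hsec }

theorem shear_sec (c : GraphChart A S) (R : A →L[ℝ] W) (hR : Function.RightInverse R c.proj)
    {t : A} (ht : t ∈ c.param) : c.shear R hR (c.sec t) = R t := by
  change c.sec t - c.sec (c.proj (c.sec t)) + R (c.proj (c.sec t)) = R t
  rw [c.proj_sec ht, sub_self, zero_add]

theorem shear_mem_maximalAtlas (c : GraphChart A S) (R : A →L[ℝ] W)
    (hR : Function.RightInverse R c.proj) :
    c.shear R hR ∈ IsManifold.maximalAtlas 𝓘(ℝ, W) ∞ W := by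
  have hsec : ContDiffOn ℝ ∞ (fun v => c.sec (c.proj v)) (c.proj ⁻¹' c.param) :=
    c.contDiffOn_sec.comp c.proj.contDiff.contDiffOn fun _ hv => hv
  have hlin : ContDiffOn ℝ ∞ (fun v => R (c.proj v)) (c.proj ⁻¹' c.param) :=
    (R.contDiff.comp c.proj.contDiff).contDiffOn
  exact OpenPartialHomeomorph.mem_maximalAtlas_of_contMDiffOn _
    ((contDiffOn_id.sub hsec).add hlin).contMDiffOn
    ((contDiffOn_id.sub hlin).add hsec).contMDiffOn

end GraphChart

/-- The manifold structure on a set that is locally a graph. -/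
abbrev graphChartedSpace (c : S → GraphChart A S) (hc : ∀ p : S, p.1 ∈ (c p).dom) :
    ChartedSpace A S where
  atlas := Set.range fun p => (c p).toChart p
  chartAt p := (c p).toChart p
  mem_chart_source p := hc p
  chart_mem_atlas p := ⟨p, rfl⟩

theorem isManifold_graphChartedSpace (c : S → GraphChart A S) (hc : ∀ p : S, p.1 ∈ (c p).dom) :
    letI := graphChartedSpace c hc
    IsManifold 𝓘(ℝ, A) ∞ S := by
  let := graphChartedSpace c hc
  refine isManifold_of_contDiffOn _ _ _ ?_
  rintro _ _ ⟨p, rfl⟩ ⟨q, rfl⟩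
  have htransition : ContDiffOn ℝ ∞ (fun t => (c q).proj ((c p).sec t)) (c p).param :=
    (c q).proj.contDiff.comp_contDiffOn (c p).contDiffOn_sec
  refine (htransition.mono fun t ht => ?_).congr fun t ht => ?_
  · simp only [mfld_simps] at ht
    exact ht.1
  · simp only [mfld_simps] at ht ⊢
    rw [GraphChart.toChart_apply, GraphChart.toChart_symm_apply _ _ ht.1]

/-- The preferred charts of the manifold `S` are given by the family `c` of graph charts. -/
def IsGraphAtlas [ChartedSpace A S] (c : S → GraphChart A S) : Prop :=
  ∀ p : S, chartAt A p = (c p).toChart p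

namespace IsGraphAtlas

variable [ChartedSpace A S] {c : S → GraphChart A S}

theorem mem_dom (hc : IsGraphAtlas c) (p : S) : p.1 ∈ (c p).dom := by
  have h := mem_chart_source A p
  rwa [hc p] at h

theorem extChartAt_apply (hc : IsGraphAtlas c) (p s : S) :
    extChartAt 𝓘(ℝ, A) p s = (c p).proj s.1 := by
  simp [hc p, mfld_simps]

theorem extChartAt_target (hc : IsGraphAtlas c) (p : S) :
    (extChartAt 𝓘(ℝ, A) p).target = (c p).param := by
  simp [hc p, mfld_simps]

theorem val_extChartAt_symm (hc : IsGraphAtlas c) (p : S) {t : A} (ht : t ∈ (c p).param) :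
    ((extChartAt 𝓘(ℝ, A) p).symm t).1 = (c p).sec t := by
  simpa [hc p, mfld_simps] using (c p).toChart_symm_apply p ht

theorem contMDiff_val (hc : IsGraphAtlas c) :
    ContMDiff 𝓘(ℝ, A) 𝓘(ℝ, W) ∞ (Subtype.val : S → W) := by
  refine fun p => (contMDiffAt_iff (n := ∞)).2 ⟨continuous_subtype_val.continuousAt, ?_⟩
  have hp : (c p).proj p.1 ∈ (c p).param := (c p).proj_mem_param p.2 (hc.mem_dom p)
  have hnhds := (c p).isOpen_param.mem_nhds hp
  rw [modelWithCornersSelf_coe, Set.range_id, contDiffWithinAt_univ, hc.extChartAt_apply]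
  refine ((c p).contDiffOn_sec.contDiffAt hnhds).congr_of_eventuallyEq ?_
  filter_upwards [hnhds] with t ht
  exact hc.val_extChartAt_symm p ht

theorem isSmoothEmbedding_val [FiniteDimensional ℝ A] [FiniteDimensional ℝ W]
    [IsManifold 𝓘(ℝ, A) ∞ S] (hc : IsGraphAtlas c) :
    Manifold.IsSmoothEmbedding 𝓘(ℝ, A) 𝓘(ℝ, W) ∞ (Subtype.val : S → W) := by
  refine ⟨Manifold.IsImmersionOfComplement.isImmersion
    (F := Fin (Module.finrank ℝ W - Module.finrank ℝ A) → ℝ) fun p => ?_,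
    Topology.IsEmbedding.subtypeVal⟩
  have hp : (c p).proj p.1 ∈ (c p).param := (c p).proj_mem_param p.2 (hc.mem_dom p)
  let R : A →L[ℝ] W := fderiv ℝ (c p).sec ((c p).proj p.1)
  have hR : Function.RightInverse R (c p).proj := (c p).proj_fderiv_sec hp
  have hker : Module.finrank ℝ (Fin (Module.finrank ℝ W - Module.finrank ℝ A) → ℝ) =
      Module.finrank ℝ (c p).proj.ker := by
    have h := (c p).proj.toLinearMap.finrank_range_add_finrank_ker
    rw [LinearMap.range_eq_top.2 hR.surjective, finrank_top] at h
    rw [Module.finrank_fin_fun]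
    omega
  let splitting := ((ContinuousLinearEquiv.refl ℝ A).prodCongr
    (ContinuousLinearEquiv.ofFinrankEq hker)).trans
    (ContinuousLinearEquiv.equivOfRightInverse (c p).proj R hR).symm
  refine Manifold.IsImmersionAtOfComplement.mk_of_continuousAt
    continuous_subtype_val.continuousAt splitting ((c p).toChart p) ((c p).shear R hR)
    (hc.mem_dom p) hp (hc p ▸ IsManifold.chart_mem_maximalAtlas p)
    ((c p).shear_mem_maximalAtlas R hR) fun t ht => ?_
  simp only [mfld_simps] at ht
  simp only [mfld_simps]
  rw [GraphChart.toChart_symm_apply _ _ ht, (c p).shear_sec R hR ht]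
  simp [splitting]

theorem mfderiv_extChartAt (hc : IsGraphAtlas c) (p s : S) (a : TangentSpace 𝓘(ℝ, A) s) :
    (mfderiv 𝓘(ℝ, A) 𝓘(ℝ, A) (extChartAt 𝓘(ℝ, A) p) s a : A) =
      (c p).proj (tangentIncl S 𝓘(ℝ, A) s a) := by
  have hchart : (extChartAt 𝓘(ℝ, A) p : S → A) = (c p).proj ∘ Subtype.val :=
    funext (hc.extChartAt_apply p)
  have hval : HasMFDerivAt 𝓘(ℝ, A) 𝓘(ℝ, W) (Subtype.val : S → W) s (tangentIncl S 𝓘(ℝ, A) s) :=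
    (hc.contMDiff_val.mdifferentiableAt (by simp)).hasMFDerivAt
  have hproj : HasMFDerivAt 𝓘(ℝ, W) 𝓘(ℝ, A) (c p).proj s.1 (c p).proj :=
    (c p).proj.hasMFDerivAt
  rw [hchart, (hproj.comp s hval).mfderiv]
  rfl

theorem tangentIncl_eq_fderiv_sec (hc : IsGraphAtlas c) {p s : S} (hs : s.1 ∈ (c p).dom)
    (a : TangentSpace 𝓘(ℝ, A) s) :
    tangentIncl S 𝓘(ℝ, A) s a =
      fderiv ℝ (c p).sec ((c p).proj s.1) ((c p).proj (tangentIncl S 𝓘(ℝ, A) s a)) := by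
  have hval : HasMFDerivAt 𝓘(ℝ, A) 𝓘(ℝ, W) (Subtype.val : S → W) s (tangentIncl S 𝓘(ℝ, A) s) :=
    (hc.contMDiff_val.mdifferentiableAt (by simp)).hasMFDerivAt
  have hproj : HasMFDerivAt 𝓘(ℝ, W) 𝓘(ℝ, A) (c p).proj s.1 (c p).proj :=
    (c p).proj.hasMFDerivAt
  have hsec : HasMFDerivAt 𝓘(ℝ, A) 𝓘(ℝ, W) (c p).sec ((c p).proj s.1)
      (fderiv ℝ (c p).sec ((c p).proj s.1)) :=
    ((c p).hasFDerivAt_sec ((c p).proj_mem_param s.2 hs)).hasMFDerivAt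
  have hval_eq : (Subtype.val : S → W) =ᶠ[𝓝 s] (c p).sec ∘ (c p).proj ∘ Subtype.val :=
    Filter.eventuallyEq_of_mem (((c p).isOpen_dom.preimage continuous_subtype_val).mem_nhds hs)
      fun y hy => ((c p).sec_proj y.2 hy).symm
  exact DFunLike.congr_fun
    (hasMFDerivAt_unique hval
      ((hsec.comp s (hproj.comp s hval)).congr_of_eventuallyEq hval_eq)) a

variable [IsManifold 𝓘(ℝ, A) ∞ S]

theorem proj_tangentIncl (hc : IsGraphAtlas c) (s : S) (a : TangentSpace 𝓘(ℝ, A) s) :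
    (c s).proj (tangentIncl S 𝓘(ℝ, A) s a) = a := by
  rw [← hc.mfderiv_extChartAt s s a, mfderiv_extChartAt_self]
  rfl

end IsGraphAtlas

end GraphChart

/-! ### The rank theorem -/

section Rank

variable {K : Type*} [Field K] {M N P : Type*} [AddCommGroup M] [Module K M]
  [AddCommGroup N] [Module K N] [FiniteDimensional K N] [AddCommGroup P] [Module K P]

theorem finrank_range_comp_le_left (f : M →ₗ[K] N) (g : P →ₗ[K] M) :
    Module.finrank K (f ∘ₗ g).range ≤ Module.finrank K f.range :=
  Submodule.finrank_mono (LinearMap.range_comp_le_range g f)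

theorem finrank_range_comp_le_right (f : M →ₗ[K] N) (g : N →ₗ[K] P) :
    Module.finrank K (g ∘ₗ f).range ≤ Module.finrank K f.range := by
  rw [LinearMap.range_comp]
  exact Submodule.finrank_map_le _ _

theorem exists_surjective_comp_of_finrank_range_eq [FiniteDimensional K P] (f : M →ₗ[K] N)
    (hf : Module.finrank K f.range = Module.finrank K P) :
    ∃ p : N →ₗ[K] P, Function.Surjective (p ∘ₗ f) := by
  obtain ⟨p, hp⟩ := LinearMap.exists_extend (LinearEquiv.ofFinrankEq f.range P hf).toLinearMap
  refine ⟨p, fun a => ?_⟩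
  obtain ⟨⟨_, m, rfl⟩, hm⟩ := (LinearEquiv.ofFinrankEq f.range P hf).surjective a
  exact ⟨m, (LinearMap.congr_fun hp ⟨f m, m, rfl⟩).trans hm⟩

theorem ker_comp_eq_ker_of_finrank_range_le [FiniteDimensional K P] (p : N →ₗ[K] P)
    (f : M →ₗ[K] N) (hsurj : Function.Surjective (p ∘ₗ f))
    (hf : Module.finrank K f.range ≤ Module.finrank K P) : (p ∘ₗ f).ker = f.ker := by
  have hp : Function.Surjective (p.domRestrict f.range) := fun a =>
    (hsurj a).imp' (fun m => ⟨f m, m, rfl⟩) fun _ hm => hm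
  have hinj : Function.Injective (p.domRestrict f.range) :=
    (LinearMap.injective_iff_surjective_of_finrank_eq_finrank
      (hf.antisymm (LinearMap.finrank_le_finrank_of_surjective hp))).2 hp
  refine le_antisymm (fun m hm => ?_) (LinearMap.ker_le_ker_comp f p)
  exact congrArg Subtype.val (hinj (a₁ := ⟨f m, m, rfl⟩) (a₂ := 0) (hm.trans (map_zero _).symm))

end Rank

section RankTheorem

variable {E : Type*} [NormedAddCommGroup E] [NormedSpace ℝ E]
  {V : Type*} [NormedAddCommGroup V] [NormedSpace ℝ V]
  {A : Type*} [NormedAddCommGroup A] [NormedSpace ℝ A]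
  {F : Type*} [NormedAddCommGroup F] [NormedSpace ℝ F]

/- Invertibility of the derivative at `a` spreads to a neighbourhood of `a`, so for `n = ∞` the
inverse is smooth on a fixed neighbourhood rather than only at the single point `f a`. -/
theorem exists_openPartialHomeomorph_contDiffOn_symm [CompleteSpace E] {n : ℕ∞ω} (hn : n ≠ 0)
    {f : E → F} {s : Set E} (hs : IsOpen s) (hf : ContDiffOn ℝ n f s) {a : E} (ha : a ∈ s)
    (hinv : (fderiv ℝ f a).IsInvertible) :
    ∃ Φ : OpenPartialHomeomorph E F, a ∈ Φ.source ∧ Φ.source ⊆ s ∧ ⇑Φ = f ∧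
      ContDiffOn ℝ n Φ.symm Φ.target := by
  have hfd : ∀ y ∈ s, HasFDerivAt f (fderiv ℝ f y) y := fun y hy =>
    ((hf.contDiffAt (hs.mem_nhds hy)).differentiableAt hn).hasFDerivAt
  obtain ⟨Λ, hΛ⟩ := hinv
  have hfa := hf.contDiffAt (hs.mem_nhds ha)
  have hΛa : HasFDerivAt f (Λ : E →L[ℝ] F) a := hΛ ▸ hfd a ha
  let U : Set E := s ∩ fderiv ℝ f ⁻¹' Set.range ContinuousLinearEquiv.toContinuousLinearMap
  have hU : IsOpen U :=
    (hf.continuousOn_fderiv_of_isOpen hs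
      (ENat.one_le_iff_ne_zero_withTop.2 hn)).isOpen_inter_preimage hs ContinuousLinearEquiv.isOpen
  let Φ := (hfa.toOpenPartialHomeomorph f hΛa hn).restrOpen U hU
  refine ⟨Φ, ⟨hfa.mem_toOpenPartialHomeomorph_source hΛa hn, ha, Λ, hΛ⟩,
    fun y hy => hy.2.1, rfl, fun z hz => ?_⟩
  obtain ⟨hzs, Λz, hΛz⟩ := (Φ.map_target hz).2
  exact (Φ.contDiffAt_symm (f₀' := Λz) hz (hΛz ▸ hfd _ hzs)
    (hf.contDiffAt (hs.mem_nhds hzs))).contDiffWithinAt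

theorem exists_openPartialHomeomorph_fst_eq [CompleteSpace E] [FiniteDimensional ℝ A] {n : ℕ∞ω}
    (hn : n ≠ 0) {f : E → A} {s : Set E} (hs : IsOpen s) (hf : ContDiffOn ℝ n f s) {a : E}
    (ha : a ∈ s) (hsurj : Function.Surjective (fderiv ℝ f a)) :
    ∃ Φ : OpenPartialHomeomorph E (A × (fderiv ℝ f a).ker), a ∈ Φ.source ∧ Φ.source ⊆ s ∧
      (∀ y, (Φ y).1 = f y) ∧ ContDiffOn ℝ n Φ.symm Φ.target := by
  obtain ⟨R, hR⟩ := (fderiv ℝ f a).exists_rightInverse_of_surjective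
    (LinearMap.range_eq_top.2 hsurj)
  let Λ := ContinuousLinearEquiv.equivOfRightInverse (fderiv ℝ f a) R
    (DFunLike.congr_fun hR)
  let Q : E →L[ℝ] (fderiv ℝ f a).ker := (ContinuousLinearMap.snd ℝ _ _).comp Λ.toContinuousLinearMap
  have hderiv : HasFDerivAt (fun y => (f y, Q y)) (Λ : E →L[ℝ] A × (fderiv ℝ f a).ker) a :=
    ((hf.contDiffAt (hs.mem_nhds ha)).differentiableAt hn).hasFDerivAt.prodMk Q.hasFDerivAt
  obtain ⟨Φ, haΦ, hΦs, hΦ, hsymm⟩ := exists_openPartialHomeomorph_contDiffOn_symm hn hs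
    (hf.prodMk Q.contDiff.contDiffOn) ha ⟨Λ, hderiv.fderiv.symm⟩
  exact ⟨Φ, haΦ, hΦs, fun y => by rw [hΦ], hsymm⟩

variable [FiniteDimensional ℝ V] [FiniteDimensional ℝ A]

theorem eq_of_finrank_range_fderiv_le {g : A × F → V} {s : Set A} {t : Set F} (hs : IsOpen s)
    (ht : IsOpen t) (htc : IsPreconnected t) (hg : DifferentiableOn ℝ g (s ×ˢ t)) (P : V →L[ℝ] A)
    (hP : ∀ z ∈ s ×ˢ t, P (g z) = z.1)
    (hrank : ∀ z ∈ s ×ˢ t, Module.finrank ℝ (fderiv ℝ g z).range ≤ Module.finrank ℝ A)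
    {a : A} (ha : a ∈ s) {k k' : F} (hk : k ∈ t) (hk' : k' ∈ t) : g (a, k) = g (a, k') := by
  have hopen : IsOpen (s ×ˢ t) := hs.prod ht
  have hgd : ∀ z ∈ s ×ˢ t, HasFDerivAt g (fderiv ℝ g z) z := fun z hz =>
    (hg.differentiableAt (hopen.mem_nhds hz)).hasFDerivAt
  have hPg : ∀ z ∈ s ×ˢ t, P.comp (fderiv ℝ g z) = ContinuousLinearMap.fst ℝ A F := fun z hz =>
    (P.hasFDerivAt.comp z (hgd z hz)).unique
      (hasFDerivAt_fst.congr_of_eventuallyEq (Filter.eventuallyEq_of_mem (hopen.mem_nhds hz) hP))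
  have hvert : ∀ z ∈ s ×ˢ t, (fderiv ℝ g z).comp (ContinuousLinearMap.inr ℝ A F) = 0 := by
    intro z hz
    have hsurj : Function.Surjective ((P : V →ₗ[ℝ] A) ∘ₗ (fderiv ℝ g z : A × F →ₗ[ℝ] V)) := by
      rw [← ContinuousLinearMap.toLinearMap_comp, hPg z hz]
      exact Prod.fst_surjective
    ext κ
    change ((0 : A), κ) ∈ (fderiv ℝ g z : A × F →ₗ[ℝ] V).ker
    rw [← ker_comp_eq_ker_of_finrank_range_le _ _ hsurj (hrank z hz)]
    exact DFunLike.congr_fun (hPg z hz) (0, κ)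
  have hslice : ∀ κ ∈ t, HasFDerivAt (fun κ => g (a, κ)) (0 : F →L[ℝ] V) κ := fun κ hκ =>
    hvert (a, κ) ⟨ha, hκ⟩ ▸ (hgd (a, κ) ⟨ha, hκ⟩).comp κ (hasFDerivAt_prodMk_right a κ)
  exact ht.is_const_of_fderiv_eq_zero (𝕜 := ℝ) htc
    (fun κ hκ => (hslice κ hκ).differentiableAt.differentiableWithinAt)
    (fun κ hκ => (hslice κ hκ).fderiv) hk hk'

theorem exists_graphChart_image_prod {g : A × F → V} {s : Set A} {t : Set F} (hs : IsOpen s)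
    (ht : IsOpen t) (htc : IsConnected t) (hg : ContDiffOn ℝ ∞ g (s ×ˢ t)) (P : V →L[ℝ] A)
    (hP : ∀ z ∈ s ×ˢ t, P (g z) = z.1)
    (hrank : ∀ z ∈ s ×ˢ t, Module.finrank ℝ (fderiv ℝ g z).range ≤ Module.finrank ℝ A) :
    ∃ c : GraphChart A (g '' s ×ˢ t), c.dom = Set.univ := by
  obtain ⟨k, hk⟩ := htc.nonempty
  have himage : (fun a => g (a, k)) '' s = g '' s ×ˢ t := by
    apply Set.Subset.antisymm
    · rintro _ ⟨a, ha, rfl⟩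
      exact ⟨(a, k), ⟨ha, hk⟩, rfl⟩
    · rintro _ ⟨⟨a, k'⟩, ⟨ha, hk'⟩, rfl⟩
      exact ⟨a, ha, eq_of_finrank_range_fderiv_le hs ht htc.isPreconnected
        (hg.differentiableOn (by simp)) P hP hrank ha hk hk'⟩
  exact ⟨{
    dom := Set.univ
    param := s
    proj := P
    sec := fun a => g (a, k)
    isOpen_dom := isOpen_univ
    isOpen_param := hs
    contDiffOn_sec := hg.comp (contDiffOn_id.prodMk contDiffOn_const) fun a ha => ⟨ha, hk⟩
    image_sec := by rw [himage, Set.inter_univ]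
    proj_sec := fun a ha => hP (a, k) ⟨ha, hk⟩ }, rfl⟩

/- A projection `P` of `V` that is an isomorphism on the range of `f'(y₀)` makes `P ∘ f` a
submersion at `y₀`. By the rank bound `f` is constant on the fibres of `P ∘ f`, so that it factors
through a section of `P`. -/
theorem exists_graphChart_image [CompleteSpace E] {f : E → V} {Ω : Set E} (hΩ : IsOpen Ω)
    (hf : ContDiffOn ℝ ∞ f Ω) {y₀ : E} (hy₀ : y₀ ∈ Ω)
    (hrank₀ : Module.finrank ℝ (fderiv ℝ f y₀).range = Module.finrank ℝ A)
    (hrank : ∀ y ∈ Ω, Module.finrank ℝ (fderiv ℝ f y).range ≤ Module.finrank ℝ A) :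
    ∃ N ⊆ Ω, IsOpen N ∧ y₀ ∈ N ∧ ∃ c : GraphChart A (f '' N), c.dom = Set.univ := by
  have hfd : ∀ y ∈ Ω, DifferentiableAt ℝ f y := fun y hy =>
    (hf.contDiffAt (hΩ.mem_nhds hy)).differentiableAt (by simp)
  obtain ⟨p, hp⟩ := exists_surjective_comp_of_finrank_range_eq (fderiv ℝ f y₀).toLinearMap hrank₀
  let P : V →L[ℝ] A := p.toContinuousLinearMap
  have hPf : fderiv ℝ (P ∘ f) y₀ = P.comp (fderiv ℝ f y₀) :=
    (P.hasFDerivAt.comp y₀ (hfd y₀ hy₀).hasFDerivAt).fderiv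
  obtain ⟨Φ, hyΦ, hΦΩ, hΦ, hsymm⟩ := exists_openPartialHomeomorph_fst_eq (by simp) hΩ
    (P.contDiff.comp_contDiffOn hf) hy₀ (hPf ▸ hp)
  obtain ⟨r, hr, hball⟩ := Metric.mem_nhds_iff.1 (Φ.open_target.mem_nhds (Φ.map_source hyΦ))
  let B := Metric.ball (Φ y₀).1 r ×ˢ Metric.ball (Φ y₀).2 r
  have hBΦ : B ⊆ Φ.target := by rwa [← ball_prod_same] at hball
  have hB : IsOpen B := Metric.isOpen_ball.prod Metric.isOpen_ball
  have hBΩ : Set.MapsTo Φ.symm B Ω := fun z hz => hΦΩ (Φ.map_target (hBΦ hz))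
  refine ⟨Φ.symm '' B, hBΩ.image_subset, Φ.symm.isOpen_image_of_subset_source hB hBΦ,
    ⟨Φ y₀, ⟨Metric.mem_ball_self hr, Metric.mem_ball_self hr⟩, Φ.left_inv hyΦ⟩, ?_⟩
  rw [← Set.image_comp]
  refine exists_graphChart_image_prod Metric.isOpen_ball Metric.isOpen_ball
    (Metric.isConnected_ball hr) (hf.comp (hsymm.mono hBΦ) hBΩ) P (fun z hz => ?_) fun z hz => ?_
  · exact (hΦ _).symm.trans (congrArg Prod.fst (Φ.right_inv (hBΦ hz)))
  · have hsymm_z : DifferentiableAt ℝ Φ.symm z :=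
      (hsymm.contDiffAt (Φ.open_target.mem_nhds (hBΦ hz))).differentiableAt (by simp)
    rw [fderiv_comp z (hfd _ (hBΩ hz)) hsymm_z]
    exact (finrank_range_comp_le_left _ _).trans (hrank _ (hBΩ hz))

theorem exists_graphChart_image_of_contMDiff [CompleteSpace E]
    {M : Type*} [TopologicalSpace M] [ChartedSpace E M] [IsManifold 𝓘(ℝ, E) ∞ M] {f : M → V}
    (hf : ContMDiff 𝓘(ℝ, E) 𝓘(ℝ, V) ∞ f) (p : M)
    (hrank₀ : Module.finrank ℝ (mfderiv 𝓘(ℝ, E) 𝓘(ℝ, V) f p).range = Module.finrank ℝ A)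
    (hrank : ∀ q, Module.finrank ℝ (mfderiv 𝓘(ℝ, E) 𝓘(ℝ, V) f q).range ≤ Module.finrank ℝ A) :
    ∃ N : Set M, IsOpen N ∧ p ∈ N ∧ ∃ c : GraphChart A (f '' N), c.dom = Set.univ := by
  let e := extChartAt 𝓘(ℝ, E) p
  have htarget : IsOpen e.target := isOpen_extChartAt_target p
  have hsymm : ContMDiffOn 𝓘(ℝ, E) 𝓘(ℝ, E) ∞ e.symm e.target := contMDiffOn_extChartAt_symm p
  have hfe : ContDiffOn ℝ ∞ (f ∘ e.symm) e.target :=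
    contMDiffOn_iff_contDiffOn.1 (hf.comp_contMDiffOn hsymm)
  have hmfderiv : fderiv ℝ (f ∘ e.symm) (e p) = mfderiv 𝓘(ℝ, E) 𝓘(ℝ, V) f p := by
    rw [(hf.mdifferentiableAt (by simp)).mfderiv, ModelWithCorners.range_eq_univ, fderivWithin_univ]
    rfl
  have hcomp : ∀ y ∈ e.target, fderiv ℝ (f ∘ e.symm) y = ContinuousLinearMap.comp
      (mfderiv 𝓘(ℝ, E) 𝓘(ℝ, V) f (e.symm y)) (mfderiv 𝓘(ℝ, E) 𝓘(ℝ, E) e.symm y) :=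
    fun y hy => by
      rw [← mfderiv_eq_fderiv]
      exact mfderiv_comp y (hf.mdifferentiableAt (by simp))
        ((hsymm.contMDiffAt (htarget.mem_nhds hy)).mdifferentiableAt (by simp))
  obtain ⟨N, hNe, hN, hpN, hc⟩ := exists_graphChart_image htarget hfe (mem_extChartAt_target p)
    (hmfderiv ▸ hrank₀) fun y hy => by
      rw [hcomp y hy]
      exact (finrank_range_comp_le_left _ _).trans (hrank _)
  refine ⟨e.symm '' N, ?_, ⟨e p, hpN, extChartAt_to_inv p⟩, by rwa [← Set.image_comp]⟩
  rw [e.symm_image_eq_source_inter_preimage hNe]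
  exact (continuousOn_extChartAt p).isOpen_inter_preimage (isOpen_extChartAt_source p) hN

end RankTheorem

/-! ### Orbits of a compact group -/

theorem exists_isOpen_range_inter_eq_image {X Y : Type*} [TopologicalSpace X] [CompactSpace X]
    [TopologicalSpace Y] [T2Space Y] {f : X → Y} (hf : Continuous f) {N : Set X}
    (hN : IsOpen (f ⁻¹' (f '' N))) : ∃ U, IsOpen U ∧ Set.range f ∩ U = f '' N := by
  refine ⟨(f '' (f ⁻¹' (f '' N))ᶜ)ᶜ, (hN.isClosed_compl.isCompact.image hf).isClosed.isOpen_compl,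
    ?_⟩
  ext y
  constructor
  · rintro ⟨⟨a, rfl⟩, ha⟩
    by_contra haN
    exact ha ⟨a, haN, rfl⟩
  · rintro ⟨a, ha, rfl⟩
    refine ⟨⟨a, rfl⟩, ?_⟩
    rintro ⟨b, hb, hba⟩
    exact hb ⟨a, ha, hba.symm⟩

section Representation

variable {G : Type*} [Group G] {V : Type*} [NormedAddCommGroup V] [NormedSpace ℝ V]

/-- A representation as a homomorphism to the group of linear automorphisms. -/
def repEquiv (ρ : G →* (V →L[ℝ] V)) : G →* (V ≃L[ℝ] V) :=
  (ContinuousLinearEquiv.unitsEquiv ℝ V).toMonoidHom.comp ρ.toHomUnits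

variable (ρ : G →* (V →L[ℝ] V))

theorem rep_one_apply (v : V) : ρ 1 v = v := by
  rw [map_one, one_apply_eq_self]

theorem rep_mul_apply (g h : G) (v : V) : ρ (g * h) v = ρ g (ρ h v) := by
  rw [map_mul, mul_apply_eq_comp]

theorem rep_inv_apply (g : G) (v : V) : ρ g⁻¹ (ρ g v) = v :=
  (repEquiv ρ g).symm_apply_apply v

theorem rep_apply_inv (g : G) (v : V) : ρ g (ρ g⁻¹ v) = v :=
  (repEquiv ρ g).apply_symm_apply v

theorem rep_mem_repOrbit_iff (x : V) (g : G) (v : V) :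
    ρ g v ∈ repOrbit ρ x ↔ v ∈ repOrbit ρ x := by
  constructor
  · rintro ⟨h, hh : ρ h x = ρ g v⟩
    exact ⟨g⁻¹ * h, (rep_mul_apply ρ g⁻¹ h x).trans (by rw [hh, rep_inv_apply])⟩
  · rintro ⟨h, rfl⟩
    exact ⟨g * h, rep_mul_apply ρ g h x⟩

theorem isOpen_preimage_image_rep_apply [TopologicalSpace G] [SeparatelyContinuousMul G] (x : V)
    {N : Set G} (hN : IsOpen N) :
    IsOpen ((fun g => ρ g x) ⁻¹' ((fun g => ρ g x) '' N)) := by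
  have hsat : (fun g => ρ g x) ⁻¹' ((fun g => ρ g x) '' N) =
      ⋃ k ∈ {k : G | ρ k x = x}, (fun g => g * k) ⁻¹' N := by
    ext g
    simp only [Set.mem_preimage, Set.mem_image, Set.mem_iUnion, Set.mem_ofPred_eq, exists_prop]
    constructor
    · rintro ⟨n, hn, hng⟩
      exact ⟨g⁻¹ * n, by rw [rep_mul_apply, hng, rep_inv_apply], by rwa [mul_inv_cancel_left]⟩
    · rintro ⟨k, hk, hgk⟩
      exact ⟨g * k, hgk, by rw [rep_mul_apply, hk]⟩
  rw [hsat]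
  exact isOpen_biUnion fun k _ => hN.preimage (continuous_mul_const k)

end Representation

section Orbit

variable {E : Type*} [NormedAddCommGroup E] [NormedSpace ℝ E]
  {G : Type*} [Group G] [TopologicalSpace G] [ChartedSpace E G]
  {V : Type*} [NormedAddCommGroup V] [NormedSpace ℝ V]

variable (E) in
/-- The infinitesimal representation as a map `v ↦ (X ↦ ρ(X) v)`, with the Lie algebra written as
the model space `E`. -/
def infAct (ρ : G →* (V →L[ℝ] V)) : V →L[ℝ] E →L[ℝ] V :=
  ContinuousLinearMap.flip (mfderiv 𝓘(ℝ, E) 𝓘(ℝ, V →L[ℝ] V) ρ 1 : E →L[ℝ] V →L[ℝ] V)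

variable {ρ : G →* (V →L[ℝ] V)}

theorem contMDiff_rep_apply (hρ : ContMDiff 𝓘(ℝ, E) 𝓘(ℝ, V →L[ℝ] V) ∞ ρ) (v : V) :
    ContMDiff 𝓘(ℝ, E) 𝓘(ℝ, V) ∞ (fun g : G => ρ g v) :=
  hρ.clm_apply contMDiff_const

theorem hasMFDerivAt_rep_apply (hρ : ContMDiff 𝓘(ℝ, E) 𝓘(ℝ, V →L[ℝ] V) ∞ ρ) (v : V) :
    HasMFDerivAt 𝓘(ℝ, E) 𝓘(ℝ, V) (fun g : G => ρ g v) 1 (infAct E ρ v) := by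
  have happly : HasMFDerivAt 𝓘(ℝ, V →L[ℝ] V) 𝓘(ℝ, V)
      (ContinuousLinearMap.apply ℝ V v) (ρ 1) (ContinuousLinearMap.apply ℝ V v) :=
    (ContinuousLinearMap.apply ℝ V v).hasMFDerivAt
  exact happly.comp (1 : G) ((hρ 1).mdifferentiableAt (by simp)).hasMFDerivAt

theorem infRep_eq_infAct (hρ : ContMDiff 𝓘(ℝ, E) 𝓘(ℝ, V →L[ℝ] V) ∞ ρ) (v : V) :
    infRep ρ v = infAct E ρ v :=
  (hasMFDerivAt_rep_apply hρ v).mfderiv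

section LieGroup

variable [LieGroup 𝓘(ℝ, E) ∞ G]

theorem mfderiv_rep_apply (hρ : ContMDiff 𝓘(ℝ, E) 𝓘(ℝ, V →L[ℝ] V) ∞ ρ) (v : V) (g : G) :
    mfderiv 𝓘(ℝ, E) 𝓘(ℝ, V) (fun k : G => ρ k v) g = ContinuousLinearMap.comp (ρ g)
      ((infAct E ρ v).comp (mfderiv 𝓘(ℝ, E) 𝓘(ℝ, E) (fun k : G => g⁻¹ * k) g)) := by
  have hmul : HasMFDerivAt 𝓘(ℝ, E) 𝓘(ℝ, E) (fun k : G => g⁻¹ * k) g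
      (mfderiv 𝓘(ℝ, E) 𝓘(ℝ, E) (fun k : G => g⁻¹ * k) g) :=
    ((contMDiff_mul_left (I := 𝓘(ℝ, E)) (n := ∞) (a := g⁻¹) g).mdifferentiableAt
      (by simp)).hasMFDerivAt
  have hrep : HasMFDerivAt 𝓘(ℝ, E) 𝓘(ℝ, V) (fun k : G => ρ k v) (g⁻¹ * g) (infAct E ρ v) :=
    (inv_mul_cancel g).symm ▸ hasMFDerivAt_rep_apply hρ v
  have hρg : HasMFDerivAt 𝓘(ℝ, V) 𝓘(ℝ, V) (ρ g) (ρ (g⁻¹ * g) v) (ρ g) := (ρ g).hasMFDerivAt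
  have hfactor : (fun k : G => ρ k v) = ρ g ∘ (fun k : G => ρ k v) ∘ fun k : G => g⁻¹ * k := by
    funext k
    simp only [Function.comp_apply]
    rw [← rep_mul_apply, mul_inv_cancel_left]
  rw [hfactor]
  exact (hρg.comp g (hrep.comp g hmul)).mfderiv

theorem infAct_rep (hρ : ContMDiff 𝓘(ℝ, E) 𝓘(ℝ, V →L[ℝ] V) ∞ ρ) (v : V) (g : G) :
    infAct E ρ (ρ g v) = (ρ g).comp ((infAct E ρ v).comp (Ad 𝓘(ℝ, E) g⁻¹)) := by
  have hconj : HasMFDerivAt 𝓘(ℝ, E) 𝓘(ℝ, E) (fun k : G => g⁻¹ * k * g⁻¹⁻¹) 1 (Ad 𝓘(ℝ, E) g⁻¹) :=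
    (((contMDiff_mul_right (I := 𝓘(ℝ, E)) (n := ∞) (a := g⁻¹⁻¹)).comp
      contMDiff_mul_left).mdifferentiableAt (by simp)).hasMFDerivAt
  have hrep : HasMFDerivAt 𝓘(ℝ, E) 𝓘(ℝ, V) (fun k : G => ρ k v) (g⁻¹ * 1 * g⁻¹⁻¹)
      (infAct E ρ v) := by
    rw [mul_one, mul_inv_cancel]
    exact hasMFDerivAt_rep_apply hρ v
  have hρg : HasMFDerivAt 𝓘(ℝ, V) 𝓘(ℝ, V) (ρ g) (ρ (g⁻¹ * 1 * g⁻¹⁻¹) v) (ρ g) :=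
    (ρ g).hasMFDerivAt
  have hfactor : (fun k : G => ρ k (ρ g v)) =
      ρ g ∘ (fun k : G => ρ k v) ∘ fun k : G => g⁻¹ * k * g⁻¹⁻¹ := by
    funext k
    simp only [Function.comp_apply]
    rw [← rep_mul_apply, ← rep_mul_apply]
    congr 2
    group
  have h := hasMFDerivAt_rep_apply hρ (ρ g v)
  rw [hfactor] at h
  exact hasMFDerivAt_unique h (hρg.comp (1 : G) (hrep.comp (1 : G) hconj))

variable [FiniteDimensional ℝ V]

theorem finrank_range_infAct_rep (hρ : ContMDiff 𝓘(ℝ, E) 𝓘(ℝ, V →L[ℝ] V) ∞ ρ) (v : V) (g : G) :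
    Module.finrank ℝ (infAct E ρ (ρ g v)).range = Module.finrank ℝ (infAct E ρ v).range := by
  have hle : ∀ (v : V) (g : G),
      Module.finrank ℝ (infAct E ρ (ρ g v)).range ≤ Module.finrank ℝ (infAct E ρ v).range :=
    fun v g => by
      rw [infAct_rep hρ v g]
      exact (finrank_range_comp_le_right _ _).trans (finrank_range_comp_le_left _ _)
  refine (hle v g).antisymm ?_
  exact (congrArg (fun u => Module.finrank ℝ (infAct E ρ u).range)
    (rep_inv_apply ρ g v)).symm.trans_le (hle (ρ g v) g⁻¹)

variable {A : Type*} [NormedAddCommGroup A] [NormedSpace ℝ A] [FiniteDimensional ℝ A]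

theorem exists_graphChart_repOrbit_self [CompleteSpace E] [CompactSpace G]
    (hρ : ContMDiff 𝓘(ℝ, E) 𝓘(ℝ, V →L[ℝ] V) ∞ ρ) (x : V)
    (hA : Module.finrank ℝ (infAct E ρ x).range = Module.finrank ℝ A) :
    ∃ c : GraphChart A (repOrbit ρ x), x ∈ c.dom := by
  have : ContinuousMul G := continuousMul_of_contMDiffMul 𝓘(ℝ, E) ∞
  have hmfderiv_one := (hasMFDerivAt_rep_apply hρ x).mfderiv
  obtain ⟨N, hN, h1N, c, hc⟩ := exists_graphChart_image_of_contMDiff (A := A)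
    (contMDiff_rep_apply hρ x) (1 : G) (hmfderiv_one ▸ hA) fun g => by
      rw [mfderiv_rep_apply hρ x g, ← hA]
      exact (finrank_range_comp_le_right _ _).trans (finrank_range_comp_le_left _ _)
  obtain ⟨U, hU, hUN⟩ := exists_isOpen_range_inter_eq_image (contMDiff_rep_apply hρ x).continuous
    (isOpen_preimage_image_rep_apply ρ x hN)
  refine ⟨c.ofInterEq hU (by rw [hc, Set.inter_univ]; exact hUN.symm), ?_⟩
  exact (hUN.superset ⟨1, h1N, rep_one_apply ρ x⟩).2

theorem exists_graphChart_repOrbit [CompleteSpace E] [CompactSpace G]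
    (hρ : ContMDiff 𝓘(ℝ, E) 𝓘(ℝ, V →L[ℝ] V) ∞ ρ) (x : V)
    (hA : Module.finrank ℝ (infAct E ρ x).range = Module.finrank ℝ A) (w : repOrbit ρ x) :
    ∃ c : GraphChart A (repOrbit ρ x), w.1 ∈ c.dom := by
  obtain ⟨c, hc⟩ := exists_graphChart_repOrbit_self hρ x hA
  obtain ⟨_, g, rfl⟩ := w
  refine ⟨c.map (repEquiv ρ g) (rep_mem_repOrbit_iff ρ x g), ?_⟩
  change ρ g⁻¹ (ρ g x) ∈ c.dom
  rwa [rep_inv_apply]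

end LieGroup

variable {A : Type*} [NormedAddCommGroup A] [NormedSpace ℝ A]

theorem infAct_eq_fderiv_sec_comp (hρ : ContMDiff 𝓘(ℝ, E) 𝓘(ℝ, V →L[ℝ] V) ∞ ρ) {x : V}
    (c : GraphChart A (repOrbit ρ x)) {w : V} (hw : w ∈ repOrbit ρ x) (hwc : w ∈ c.dom) :
    infAct E ρ w = (fderiv ℝ c.sec (c.proj w)).comp (c.proj.comp (infAct E ρ w)) := by
  have hrep := hasMFDerivAt_rep_apply hρ w
  have hproj : HasMFDerivAt 𝓘(ℝ, V) 𝓘(ℝ, A) c.proj (ρ 1 w) c.proj := c.proj.hasMFDerivAt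
  have hsec : HasMFDerivAt 𝓘(ℝ, A) 𝓘(ℝ, V) c.sec (c.proj (ρ 1 w))
      (fderiv ℝ c.sec (c.proj w)) := by
    rw [rep_one_apply]
    exact (c.hasFDerivAt_sec (c.proj_mem_param hw hwc)).hasMFDerivAt
  have hrep_eq : (fun g : G => ρ g w) =ᶠ[𝓝 1] c.sec ∘ c.proj ∘ fun g : G => ρ g w :=
    Filter.eventuallyEq_of_mem ((c.isOpen_dom.preimage
      (contMDiff_rep_apply hρ w).continuous).mem_nhds (by rwa [Set.mem_preimage, rep_one_apply]))
      fun g hg => (c.sec_proj ((rep_mem_repOrbit_iff ρ x g w).2 hw) hg).symm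
  exact hasMFDerivAt_unique hrep
    ((hsec.comp (1 : G) (hproj.comp (1 : G) hrep)).congr_of_eventuallyEq hrep_eq)

theorem surjective_proj_comp_infAct [LieGroup 𝓘(ℝ, E) ∞ G] [FiniteDimensional ℝ V]
    [FiniteDimensional ℝ A] (hρ : ContMDiff 𝓘(ℝ, E) 𝓘(ℝ, V →L[ℝ] V) ∞ ρ) {x : V}
    (hA : Module.finrank ℝ (infAct E ρ x).range = Module.finrank ℝ A)
    (c : GraphChart A (repOrbit ρ x)) {w : V} (hw : w ∈ repOrbit ρ x) (hwc : w ∈ c.dom) :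
    Function.Surjective (c.proj.comp (infAct E ρ w)) := by
  have hrank : Module.finrank ℝ (infAct E ρ w).range = Module.finrank ℝ A := by
    obtain ⟨g, rfl⟩ := hw
    exact (finrank_range_infAct_rep hρ x g).trans hA
  have hinj : Function.Injective
      (c.proj.toLinearMap.domRestrict (infAct E ρ w).range) := by
    rw [injective_iff_map_eq_zero]
    rintro ⟨_, X, rfl⟩ (hX : c.proj (infAct E ρ w X) = 0)
    refine Subtype.ext ((DFunLike.congr_fun (infAct_eq_fderiv_sec_comp hρ c hw hwc) X).trans ?_)
    rw [ContinuousLinearMap.comp_apply, ContinuousLinearMap.comp_apply, hX, map_zero]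
    rfl
  intro a
  obtain ⟨⟨_, X, rfl⟩, hX⟩ :=
    (LinearMap.injective_iff_surjective_of_finrank_eq_finrank hrank).1 hinj a
  exact ⟨X, hX⟩

end Orbit

/-! ### The differential of a representation of a Lie group -/

section Bracket

variable {E : Type*} [NormedAddCommGroup E] [NormedSpace ℝ E]
  {H : Type*} [TopologicalSpace H] {I : ModelWithCorners ℝ E H}
  {M : Type*} [TopologicalSpace M] [ChartedSpace H M]
  {V : Type*} [NormedAddCommGroup V] [NormedSpace ℝ V]

/-- The derivative of a vector-valued function along a vector field. -/
def derivAlong (I : ModelWithCorners ℝ E H) (F : M → V) (X : ∀ p : M, TangentSpace I p) (p : M) :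
    V :=
  mfderiv I 𝓘(ℝ, V) F p (X p)

/-- A vector field on a manifold without boundary, read in the preferred chart at `x`. -/
def chartVectorField (I : ModelWithCorners ℝ E H) (x : M) (X : ∀ p : M, TangentSpace I p) :
    E → E :=
  VectorField.mpullbackWithin 𝓘(ℝ, E) I (extChartAt I x).symm X (Set.range I)

theorem chartVectorField_extChartAt_self [IsManifold I 1 M] (x : M)
    (X : ∀ p : M, TangentSpace I p) :
    chartVectorField I x X (extChartAt I x x) = X x := by
  let T : E →L[ℝ] E :=
    mfderivWithin 𝓘(ℝ, E) I (extChartAt I x).symm (Set.range I) (extChartAt I x x)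
  have hT : T = ContinuousLinearMap.id ℝ E := mfderivWithin_range_extChartAt_symm
  change T.inverse (X ((extChartAt I x).symm (extChartAt I x x))) = X x
  rw [hT, ContinuousLinearMap.inverse_id, extChartAt_to_inv]
  rfl

variable [I.Boundaryless]

theorem mfderiv_eq_fderiv_comp_extChartAt_symm [IsManifold I 1 M] (f : M → V) (x : M) :
    mfderiv I 𝓘(ℝ, V) f x = fderiv ℝ (f ∘ (extChartAt I x).symm) (extChartAt I x x) := by
  by_cases hf : MDifferentiableAt I 𝓘(ℝ, V) f x
  · rw [hf.mfderiv, I.range_eq_univ, fderivWithin_univ]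
    rfl
  · rw [mfderiv_zero_of_not_mdifferentiableAt hf, fderiv_zero_of_not_differentiableAt]
    · rfl
    · intro hchart
      refine hf ((hchart.mdifferentiableAt.comp x (mdifferentiableAt_extChartAt
        (mem_chart_source H x))).congr_of_eventuallyEq ?_)
      filter_upwards [extChartAt_source_mem_nhds (I := I) x] with y hy
      exact congrArg f ((extChartAt I x).left_inv hy).symm

theorem derivAlong_eq_fderiv_comp_extChartAt_symm [IsManifold I 1 M] (F : M → V)
    (X : ∀ p : M, TangentSpace I p) (x : M) :
    derivAlong I F X x = fderiv ℝ (F ∘ (extChartAt I x).symm) (extChartAt I x x) (X x) :=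
  DFunLike.congr_fun (mfderiv_eq_fderiv_comp_extChartAt_symm F x) (X x)

section OneManifold

variable [IsManifold I 1 M] (x : M)

theorem mfderiv_extChartAt_symm_chartVectorField (X : ∀ p : M, TangentSpace I p) {y : E}
    (hy : y ∈ (extChartAt I x).target) :
    mfderiv 𝓘(ℝ, E) I (extChartAt I x).symm y (chartVectorField (E := E) I x X y) =
      X ((extChartAt I x).symm y) := by
  have hinvertible := isInvertible_mfderivWithin_extChartAt_symm (I := I) hy
  have happly : mfderivWithin 𝓘(ℝ, E) I (extChartAt I x).symm (Set.range I) y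
      (chartVectorField (E := E) I x X y) = X ((extChartAt I x).symm y) :=
    hinvertible.self_apply_inverse _
  rw [I.range_eq_univ, mfderivWithin_univ] at happly
  exact happly

theorem mlieBracket_eq_lieBracket_chartVectorField (X Y : ∀ p : M, TangentSpace I p) :
    VectorField.mlieBracket I X Y x = VectorField.lieBracket ℝ (chartVectorField I x X)
      (chartVectorField I x Y) (extChartAt I x x) := by
  let T : E →L[ℝ] E := mfderiv I 𝓘(ℝ, E) (extChartAt I x) x
  have hT : T = ContinuousLinearMap.id ℝ E := mfderiv_extChartAt_self
  change T.inverse (VectorField.lieBracketWithin ℝ (chartVectorField I x X)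
    (chartVectorField I x Y) ((extChartAt I x).symm ⁻¹' Set.univ ∩ Set.range I) _) = _
  rw [hT, ContinuousLinearMap.inverse_id, Set.preimage_univ, Set.univ_inter, I.range_eq_univ,
    VectorField.lieBracketWithin_univ]
  rfl

theorem derivAlong_comp_extChartAt_symm_eventuallyEq {F : M → V}
    (hF : MDifferentiable I 𝓘(ℝ, V) F) (X : ∀ p : M, TangentSpace I p) :
    derivAlong I F X ∘ (extChartAt I x).symm =ᶠ[𝓝 (extChartAt I x x)]
      fun y => fderiv ℝ (F ∘ (extChartAt I x).symm) y (chartVectorField I x X y) := by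
  filter_upwards [extChartAt_target_mem_nhds (I := I) x] with y hy
  have hsymm : MDifferentiableAt 𝓘(ℝ, E) I (extChartAt I x).symm y :=
    ((contMDiffOn_extChartAt_symm (n := 1) x).contMDiffAt
      ((isOpen_extChartAt_target x).mem_nhds hy)).mdifferentiableAt one_ne_zero
  have hchain := mfderiv_comp_apply y (hF _) hsymm (chartVectorField (E := E) I x X y)
  rw [mfderiv_extChartAt_symm_chartVectorField x X hy, mfderiv_eq_fderiv] at hchain
  exact hchain.symm

end OneManifold

theorem differentiableAt_chartVectorField [IsManifold I 2 M] [CompleteSpace E] {x : M}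
    {X : ∀ p : M, TangentSpace I p}
    (hX : MDifferentiableAt I I.tangent (fun p => (X p : TangentBundle I M)) x) :
    DifferentiableAt ℝ (chartVectorField I x X) (extChartAt I x x) := by
  have hpullback := MDifferentiableWithinAt.differentiableWithinAt_mpullbackWithin_vectorField
    (mdifferentiableWithinAt_univ.2 hX)
  rw [Set.preimage_univ, Set.univ_inter] at hpullback
  exact hpullback.differentiableAt (by rw [I.range_eq_univ]; exact Filter.univ_mem)

theorem derivAlong_mlieBracket [IsManifold I 2 M] [CompleteSpace E] {F : M → V}
    (hF : ContMDiff I 𝓘(ℝ, V) 2 F) {X Y : ∀ p : M, TangentSpace I p} {x : M}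
    (hX : MDifferentiableAt I I.tangent (fun p => (X p : TangentBundle I M)) x)
    (hY : MDifferentiableAt I I.tangent (fun p => (Y p : TangentBundle I M)) x) :
    derivAlong I F (VectorField.mlieBracket I X Y) x =
      derivAlong I (derivAlong I F Y) X x - derivAlong I (derivAlong I F X) Y x := by
  have : IsManifold I 1 M := .of_le one_le_two
  have hFd : MDifferentiable I 𝓘(ℝ, V) F := hF.mdifferentiable two_ne_zero
  have hFchart : ContDiffAt ℝ 2 (F ∘ (extChartAt I x).symm) (extChartAt I x x) :=
    (contMDiffOn_iff_contDiffOn.1 (hF.comp_contMDiffOn (contMDiffOn_extChartAt_symm x))).contDiffAt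
      (extChartAt_target_mem_nhds x)
  have hchart := VectorField.fderiv_apply_lieBracket hFchart (by simp)
    (differentiableAt_chartVectorField hY) (differentiableAt_chartVectorField hX)
  rw [← (derivAlong_comp_extChartAt_symm_eventuallyEq x hFd X).fderiv_eq,
    ← (derivAlong_comp_extChartAt_symm_eventuallyEq x hFd Y).fderiv_eq,
    chartVectorField_extChartAt_self, chartVectorField_extChartAt_self] at hchart
  rw [derivAlong_eq_fderiv_comp_extChartAt_symm, derivAlong_eq_fderiv_comp_extChartAt_symm,
    derivAlong_eq_fderiv_comp_extChartAt_symm, mlieBracket_eq_lieBracket_chartVectorField]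
  exact hchart

end Bracket

section LieGroup

variable {E : Type*} [NormedAddCommGroup E] [NormedSpace ℝ E]
  {H : Type*} [TopologicalSpace H] {I : ModelWithCorners ℝ E H}
  {L : Type*} [TopologicalSpace L] [ChartedSpace H L] [Group L]
  {V : Type*} [NormedAddCommGroup V] [NormedSpace ℝ V]

theorem mulInvariantVectorField_one (Z : GroupLieAlgebra I L) :
    mulInvariantVectorField Z (1 : L) = Z := by
  have hid : (fun k : L => 1 * k) = id := funext one_mul
  rw [mulInvariantVectorField, hid, mfderiv_id]
  rfl

variable {R : L →* (V →L[ℝ] V)} {D : E →L[ℝ] V →L[ℝ] V}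

theorem hasMFDerivAt_rep_mul (hD : HasMFDerivAt I 𝓘(ℝ, V →L[ℝ] V) R 1 D) (T : V →L[ℝ] V) :
    HasMFDerivAt I 𝓘(ℝ, V →L[ℝ] V) (fun g : L => R g * T) 1
      (((ContinuousLinearMap.mul ℝ (V →L[ℝ] V)).flip T).comp D) :=
  (ContinuousLinearMap.hasMFDerivAt
    (f := (ContinuousLinearMap.mul ℝ (V →L[ℝ] V)).flip T)).comp (1 : L) hD

variable [LieGroup I ∞ L]

theorem derivAlong_rep_mulInvariantVectorField (hR : ContMDiff I 𝓘(ℝ, V →L[ℝ] V) ∞ R)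
    (hD : HasMFDerivAt I 𝓘(ℝ, V →L[ℝ] V) R 1 D) (Z : GroupLieAlgebra I L) (g : L) :
    derivAlong I R (mulInvariantVectorField Z) g = R g * D Z := by
  have hmul : MDifferentiableAt I I (fun k : L => g * k) 1 :=
    (contMDiff_mul_left (I := I) (n := ∞) (a := g) 1).mdifferentiableAt (by simp)
  have hRg : MDifferentiableAt I 𝓘(ℝ, V →L[ℝ] V) R (g * 1) := (hR _).mdifferentiableAt (by simp)
  have hcomp : (R ∘ fun k : L => g * k) = ContinuousLinearMap.mul ℝ (V →L[ℝ] V) (R g) ∘ R := by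
    funext k
    exact map_mul R g k
  have hleft := mfderiv_comp_apply (1 : L) hRg hmul Z
  have hright := ((ContinuousLinearMap.hasMFDerivAt (x := R 1)
    (f := ContinuousLinearMap.mul ℝ (V →L[ℝ] V) (R g))).comp (1 : L) hD).mfderiv
  rw [hcomp, hright, mul_one] at hleft
  exact hleft.symm

theorem mfderiv_rep_bracket [I.Boundaryless] [CompleteSpace E]
    (hR : ContMDiff I 𝓘(ℝ, V →L[ℝ] V) ∞ R) (hD : HasMFDerivAt I 𝓘(ℝ, V →L[ℝ] V) R 1 D)
    (X Y : GroupLieAlgebra I L) :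
    D (⁅X, Y⁆ : GroupLieAlgebra I L) = D X * D Y - D Y * D X := by
  have : LieGroup I (minSmoothness ℝ 3) L := .of_le (n := ∞) (by simpa using ENat.LEInfty.out)
  have : IsManifold I 2 L := .of_le (n := ∞) ENat.LEInfty.out
  have hbracket := derivAlong_mlieBracket (hR.of_le ENat.LEInfty.out) (x := (1 : L))
    (mdifferentiableAt_mulInvariantVectorField X) (mdifferentiableAt_mulInvariantVectorField Y)
  rw [funext (derivAlong_rep_mulInvariantVectorField hR hD X),
    funext (derivAlong_rep_mulInvariantVectorField hR hD Y), derivAlong, derivAlong, derivAlong,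
    hD.mfderiv, (hasMFDerivAt_rep_mul hD _).mfderiv, (hasMFDerivAt_rep_mul hD _).mfderiv,
    mulInvariantVectorField_one, mulInvariantVectorField_one] at hbracket
  exact hbracket

end LieGroup

/-! ### Cotangent coordinates -/

section CotangentCoordinates

variable {A : Type*} [NormedAddCommGroup A] [NormedSpace ℝ A]
  {M : Type*} [TopologicalSpace M] [ChartedSpace A M] [IsManifold 𝓘(ℝ, A) ∞ M]

theorem mem_extChartAt_cotangent_source (γ₀ γ : CotangentBundle 𝓘(ℝ, A) M) :
    γ ∈ (extChartAt (cotangentModel 𝓘(ℝ, A)) γ₀).source ↔ γ.proj ∈ (chartAt A γ₀.proj).source := by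
  rw [FiberBundle.extChartAt]
  simp only [PartialEquiv.trans_source, hom_trivializationAt_source,
    PartialEquiv.prod_source, PartialEquiv.refl_source, extChartAt_source, Set.mem_inter_iff,
    Set.mem_preimage, Set.mem_prod, Set.mem_univ, and_true]
  exact ⟨fun hmem => hmem.1.1, fun hmem => ⟨⟨hmem, trivial⟩, hmem⟩⟩

theorem extChartAt_cotangent_target (γ₀ : CotangentBundle 𝓘(ℝ, A) M) :
    (extChartAt (cotangentModel 𝓘(ℝ, A)) γ₀).target =
      (extChartAt 𝓘(ℝ, A) γ₀.proj).target ×ˢ Set.univ := by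
  rw [FiberBundle.extChartAt_target, hom_trivializationAt_baseSet]
  congr 1
  refine Set.inter_eq_left.2 fun t ht => ?_
  refine ⟨?_, trivial⟩
  have hsource := (extChartAt 𝓘(ℝ, A) γ₀.proj).map_target ht
  rwa [extChartAt_source] at hsource

theorem extChartAt_cotangent_apply (γ₀ γ : CotangentBundle 𝓘(ℝ, A) M) :
    extChartAt (cotangentModel 𝓘(ℝ, A)) γ₀ γ = (extChartAt 𝓘(ℝ, A) γ₀.proj γ.proj,
      ContinuousLinearMap.inCoordinates A (TangentSpace 𝓘(ℝ, A)) ℝ (Bundle.Trivial M ℝ)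
        γ₀.proj γ.proj γ₀.proj γ.proj γ.snd) := by
  rw [FiberBundle.extChartAt]
  rfl

theorem cotangent_snd_apply (γ₀ γ : CotangentBundle 𝓘(ℝ, A) M)
    (hγ : γ.proj ∈ (chartAt A γ₀.proj).source) (a : TangentSpace 𝓘(ℝ, A) γ.proj) :
    γ.snd a = (extChartAt (cotangentModel 𝓘(ℝ, A)) γ₀ γ).2
      (mfderiv 𝓘(ℝ, A) 𝓘(ℝ, A) (extChartAt 𝓘(ℝ, A) γ₀.proj) γ.proj a) := by
  rw [extChartAt_cotangent_apply, ← TangentBundle.continuousLinearMapAt_trivializationAt hγ]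
  have hbase : γ.proj ∈ (trivializationAt A (TangentSpace 𝓘(ℝ, A)) γ₀.proj).baseSet := hγ
  have hsymmL := (trivializationAt A (TangentSpace 𝓘(ℝ, A)) γ₀.proj).symmL_continuousLinearMapAt
    (R := ℝ) hbase a
  refine (congrArg γ.snd hsymmL.symm).trans ?_
  exact (DFunLike.congr_fun
    (Bundle.Trivial.continuousLinearMapAt_trivialization ℝ M ℝ γ.proj) _).symm

theorem mfderiv_extChartAt_comp_proj_comp_symm (γ₀ : CotangentBundle 𝓘(ℝ, A) M)
    {y : A × (A →L[ℝ] ℝ)} (hy : y ∈ (extChartAt (cotangentModel 𝓘(ℝ, A)) γ₀).target)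
    (a : A × (A →L[ℝ] ℝ)) :
    mfderiv 𝓘(ℝ, A) 𝓘(ℝ, A) (extChartAt 𝓘(ℝ, A) γ₀.proj)
      ((extChartAt (cotangentModel 𝓘(ℝ, A)) γ₀).symm y).proj
      (mfderiv (cotangentModel 𝓘(ℝ, A)) 𝓘(ℝ, A) (fun γ : CotangentBundle 𝓘(ℝ, A) M => γ.proj)
        ((extChartAt (cotangentModel 𝓘(ℝ, A)) γ₀).symm y)
        (mfderiv 𝓘(ℝ, A × (A →L[ℝ] ℝ)) (cotangentModel 𝓘(ℝ, A))
          (extChartAt (cotangentModel 𝓘(ℝ, A)) γ₀).symm y a)) = a.1 := by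
  set e := extChartAt (cotangentModel 𝓘(ℝ, A)) γ₀ with he
  have htarget : e.target ∈ 𝓝 y := (isOpen_extChartAt_target γ₀).mem_nhds hy
  have hsymm : MDifferentiableAt 𝓘(ℝ, A × (A →L[ℝ] ℝ)) (cotangentModel 𝓘(ℝ, A)) e.symm y :=
    ((contMDiffOn_extChartAt_symm (n := ∞) γ₀).contMDiffAt htarget).mdifferentiableAt (by simp)
  have hproj : MDifferentiableAt (cotangentModel 𝓘(ℝ, A)) 𝓘(ℝ, A)
      (fun γ : CotangentBundle 𝓘(ℝ, A) M => γ.proj) (e.symm y) :=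
    (Bundle.contMDiffAt_proj (n := ∞) _).mdifferentiableAt (by simp)
  have hchart : MDifferentiableAt 𝓘(ℝ, A) 𝓘(ℝ, A) (extChartAt 𝓘(ℝ, A) γ₀.proj)
      (e.symm y).proj :=
    mdifferentiableAt_extChartAt
      ((mem_extChartAt_cotangent_source γ₀ (e.symm y)).1 (e.map_target hy))
  have hchain : HasMFDerivAt 𝓘(ℝ, A × (A →L[ℝ] ℝ)) 𝓘(ℝ, A)
      (extChartAt 𝓘(ℝ, A) γ₀.proj ∘ (fun γ : CotangentBundle 𝓘(ℝ, A) M => γ.proj) ∘ e.symm) y _ :=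
    hchart.hasMFDerivAt.comp y (hproj.hasMFDerivAt.comp y hsymm.hasMFDerivAt)
  have hfst : HasMFDerivAt 𝓘(ℝ, A × (A →L[ℝ] ℝ)) 𝓘(ℝ, A)
      (extChartAt 𝓘(ℝ, A) γ₀.proj ∘ (fun γ : CotangentBundle 𝓘(ℝ, A) M => γ.proj) ∘ e.symm) y
      (ContinuousLinearMap.fst ℝ A (A →L[ℝ] ℝ)) := by
    refine (ContinuousLinearMap.fst ℝ A (A →L[ℝ] ℝ)).hasMFDerivAt.congr_of_eventuallyEq ?_
    filter_upwards [htarget] with z hz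
    have hz_apply := extChartAt_cotangent_apply γ₀ (e.symm z)
    rw [← he, e.right_inv hz] at hz_apply
    exact (congrArg Prod.fst hz_apply).symm
  exact DFunLike.congr_fun (hasMFDerivAt_unique hchain hfst) a

theorem tautologicalForm_extChartAt_symm (γ₀ : CotangentBundle 𝓘(ℝ, A) M)
    {y : A × (A →L[ℝ] ℝ)} (hy : y ∈ (extChartAt (cotangentModel 𝓘(ℝ, A)) γ₀).target)
    (a : A × (A →L[ℝ] ℝ)) :
    tautologicalForm 𝓘(ℝ, A) M ((extChartAt (cotangentModel 𝓘(ℝ, A)) γ₀).symm y)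
      (mfderiv 𝓘(ℝ, A × (A →L[ℝ] ℝ)) (cotangentModel 𝓘(ℝ, A))
        (extChartAt (cotangentModel 𝓘(ℝ, A)) γ₀).symm y a) = y.2 a.1 := by
  set e := extChartAt (cotangentModel 𝓘(ℝ, A)) γ₀ with he
  have hsource := (mem_extChartAt_cotangent_source γ₀ (e.symm y)).1 (e.map_target hy)
  refine (cotangent_snd_apply γ₀ (e.symm y) hsource _).trans ?_
  rw [← he, e.right_inv hy]
  exact congrArg y.2 (mfderiv_extChartAt_comp_proj_comp_symm γ₀ hy a)

theorem canonicalForm_eq (γ : CotangentBundle 𝓘(ℝ, A) M)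
    (a b : TangentSpace (cotangentModel 𝓘(ℝ, A)) γ) (a' b' : A × (A →L[ℝ] ℝ))
    (ha : mfderiv (cotangentModel 𝓘(ℝ, A)) 𝓘(ℝ, A × (A →L[ℝ] ℝ))
      (extChartAt (cotangentModel 𝓘(ℝ, A)) γ) γ a = a')
    (hb : mfderiv (cotangentModel 𝓘(ℝ, A)) 𝓘(ℝ, A × (A →L[ℝ] ℝ))
      (extChartAt (cotangentModel 𝓘(ℝ, A)) γ) γ b = b') :
    canonicalForm 𝓘(ℝ, A) M γ a b = b'.2 a'.1 - a'.2 b'.1 := by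
  let pdq : (A × (A →L[ℝ] ℝ)) →L[ℝ] (A × (A →L[ℝ] ℝ)) →L[ℝ] ℝ :=
    ((ContinuousLinearMap.compL ℝ (A × (A →L[ℝ] ℝ)) A ℝ).flip
      (ContinuousLinearMap.fst ℝ A (A →L[ℝ] ℝ))).comp (ContinuousLinearMap.snd ℝ A (A →L[ℝ] ℝ))
  let e := extChartAt (cotangentModel 𝓘(ℝ, A)) γ
  let θ : A × (A →L[ℝ] ℝ) → ((A × (A →L[ℝ] ℝ)) →L[ℝ] ℝ) := fun y =>
    (tautologicalForm 𝓘(ℝ, A) M (e.symm y)).comp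
      (mfderiv 𝓘(ℝ, A × (A →L[ℝ] ℝ)) (cotangentModel 𝓘(ℝ, A)) e.symm y)
  have hθ : θ =ᶠ[𝓝 (e γ)] pdq := by
    filter_upwards [extChartAt_target_mem_nhds (I := cotangentModel 𝓘(ℝ, A)) γ] with y hy
    exact ContinuousLinearMap.ext (tautologicalForm_extChartAt_symm γ hy)
  have hfderiv : fderiv ℝ θ (e γ) = pdq := by
    rw [hθ.fderiv_eq]
    exact ContinuousLinearMap.fderiv (E := A × (A →L[ℝ] ℝ))
      (F := (A × (A →L[ℝ] ℝ)) →L[ℝ] ℝ) pdq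
  have hform : canonicalForm 𝓘(ℝ, A) M γ a b =
      -(fderiv ℝ θ (e γ) a' b' - fderiv ℝ θ (e γ) b' a') := by
    rw [← ha, ← hb]
    rfl
  rw [hform, hfderiv]
  exact neg_sub (a'.2 b'.1) (b'.2 a'.1)

end CotangentCoordinates

section GraphAtlas

variable {A : Type*} [NormedAddCommGroup A] [NormedSpace ℝ A]
  {W : Type*} [NormedAddCommGroup W] [NormedSpace ℝ W] {S : Set W} [ChartedSpace A S]
  [IsManifold 𝓘(ℝ, A) ∞ S] {c : S → GraphChart A S}

theorem IsGraphAtlas.mem_extChartAt_cotangent_target_iff (hc : IsGraphAtlas c)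
    (γ₀ : CotangentBundle 𝓘(ℝ, A) S) (y : A × (A →L[ℝ] ℝ)) :
    y ∈ (extChartAt (cotangentModel 𝓘(ℝ, A)) γ₀).target ↔ y.1 ∈ (c γ₀.proj).param := by
  rw [extChartAt_cotangent_target, hc.extChartAt_target]
  exact and_iff_left trivial

theorem IsGraphAtlas.extChartAt_cotangent_self_fst_mem_param (hc : IsGraphAtlas c)
    (γ : CotangentBundle 𝓘(ℝ, A) S) :
    (extChartAt (cotangentModel 𝓘(ℝ, A)) γ γ).1 ∈ (c γ.proj).param :=
  (hc.mem_extChartAt_cotangent_target_iff γ _).1 (mem_extChartAt_target γ)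

end GraphAtlas

/-! ### Invariant inner products -/

section InvariantInner

open MeasureTheory

variable {G : Type*} [Group G] [TopologicalSpace G] [IsTopologicalGroup G]
  {V : Type*} [NormedAddCommGroup V] [NormedSpace ℝ V]

theorem continuous_bilinearComp_rep_inv {ρ : G →* (V →L[ℝ] V)} (hρ : Continuous ρ)
    (B : V →L[ℝ] V →L[ℝ] ℝ) : Continuous fun g => B.bilinearComp (ρ g⁻¹) (ρ g⁻¹) :=
  have hinv : Continuous fun g => ρ g⁻¹ := hρ.comp continuous_inv
  (ContinuousLinearMap.flipₗᵢ ℝ V V ℝ).continuous.comp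
    (((ContinuousLinearMap.flipₗᵢ ℝ V V ℝ).continuous.comp
      (continuous_const.clm_comp hinv)).clm_comp hinv)

variable [CompactSpace G]

section HaarAverage

variable [MeasurableSpace G] [BorelSpace G]

/-- The average of a bilinear form over a representation of a compact group, with respect to Haar
measure. -/
def haarAverage (ρ : G →* (V →L[ℝ] V)) (B : V →L[ℝ] V →L[ℝ] ℝ) : V →L[ℝ] V →L[ℝ] ℝ :=
  ∫ g, B.bilinearComp (ρ g⁻¹) (ρ g⁻¹) ∂Measure.haar

variable {ρ : G →* (V →L[ℝ] V)} {B : V →L[ℝ] V →L[ℝ] ℝ}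

set_option maxSynthPendingDepth 2 in
theorem haarAverage_apply (hρ : Continuous ρ) (v w : V) :
    haarAverage ρ B v w = ∫ g, B (ρ g⁻¹ v) (ρ g⁻¹ w) ∂Measure.haar := by
  have hint : Integrable (fun g => B.bilinearComp (ρ g⁻¹) (ρ g⁻¹)) (Measure.haar : Measure G) :=
    (continuous_bilinearComp_rep_inv hρ B).integrable_of_hasCompactSupport (.of_compactSpace _)
  rw [haarAverage, ContinuousLinearMap.integral_apply hint,
    ContinuousLinearMap.integral_apply (hint.apply_continuousLinearMap v)]
  rfl

theorem isInvariantInner_haarAverage (hρ : Continuous ρ) (hsymm : ∀ v w, B v w = B w v)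
    (hpos : ∀ v, v ≠ 0 → 0 < B v v) : IsInvariantInner ρ (haarAverage ρ B) where
  symm v w := by simp only [haarAverage_apply hρ, hsymm (ρ _ v)]
  pos v hv := by
    have hnonneg (u : V) : 0 ≤ B u u := by
      obtain rfl | hu := eq_or_ne u 0
      · rw [map_zero]
      · exact (hpos u hu).le
    have hcont : Continuous fun g => B (ρ g⁻¹ v) (ρ g⁻¹ v) :=
      ((continuous_bilinearComp_rep_inv hρ B).clm_apply continuous_const).clm_apply
        continuous_const
    rw [haarAverage_apply hρ]
    refine hcont.integral_pos_of_hasCompactSupport_nonneg_nonzero (x := 1) (.of_compactSpace _)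
      (fun g => hnonneg _) ?_
    rw [inv_one, rep_one_apply]
    exact (hpos v hv).ne'
  invariant h v w := by
    rw [haarAverage_apply hρ, haarAverage_apply hρ,
      ← integral_mul_left_eq_self (fun g => B (ρ g⁻¹ v) (ρ g⁻¹ w)) h⁻¹]
    simp only [mul_inv_rev, inv_inv, rep_mul_apply]

end HaarAverage

theorem exists_isInvariantInner [FiniteDimensional ℝ V] (ρ : G →* (V →L[ℝ] V))
    (hρ : Continuous ρ) : ∃ B : V →L[ℝ] V →L[ℝ] ℝ, IsInvariantInner ρ B := by
  let : MeasurableSpace G := borel G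
  have : BorelSpace G := ⟨rfl⟩
  let K : V ≃L[ℝ] EuclideanSpace ℝ (Fin (Module.finrank ℝ V)) :=
    ContinuousLinearEquiv.ofFinrankEq finrank_euclideanSpace_fin.symm
  let B : V →L[ℝ] V →L[ℝ] ℝ :=
    (innerSL ℝ (E := EuclideanSpace ℝ (Fin (Module.finrank ℝ V)))).bilinearComp
      K.toContinuousLinearMap K.toContinuousLinearMap
  exact ⟨haarAverage ρ B, isInvariantInner_haarAverage hρ
    (fun v w => real_inner_comm (K w) (K v)) fun v hv =>
      real_inner_self_pos.2 (K.map_ne_zero_iff.2 hv)⟩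

end InvariantInner

section Duality

variable {V : Type*} [NormedAddCommGroup V] [NormedSpace ℝ V]
  {G : Type*} [Group G] {ρ : G →* (V →L[ℝ] V)} {B : V →L[ℝ] V →L[ℝ] ℝ}

theorem IsInvariantInner.injective (hB : IsInvariantInner ρ B) : Function.Injective B := by
  rw [injective_iff_map_eq_zero]
  intro v hv
  by_contra hne
  exact (hB.pos v hne).ne' (DFunLike.congr_fun hv v)

variable [FiniteDimensional ℝ V]

/-- The isomorphism `V ≃ V*` defined by an invariant inner product. -/
def IsInvariantInner.toDual (hB : IsInvariantInner ρ B) : V ≃L[ℝ] (V →L[ℝ] ℝ) :=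
  (LinearEquiv.ofInjectiveOfFinrankEq (B : V →ₗ[ℝ] (V →L[ℝ] ℝ)) hB.injective
    (Subspace.dual_finrank_eq.symm.trans
      LinearMap.toContinuousLinearMap.finrank_eq)).toContinuousLinearEquiv

theorem IsInvariantInner.apply_toDual_symm (hB : IsInvariantInner ρ B) (f : V →L[ℝ] ℝ) :
    B (hB.toDual.symm f) = f := hB.toDual.apply_symm_apply f

theorem IsInvariantInner.toDual_symm_apply (hB : IsInvariantInner ρ B) (v : V) :
    hB.toDual.symm (B v) = v := hB.toDual.symm_apply_apply v

end Duality

/-! ### The Lie algebra of a semi-direct product -/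

theorem hasMFDerivAt_prodMk_space {E' H' M E₁ E₂ : Type*} [NormedAddCommGroup E']
    [NormedSpace ℝ E'] [TopologicalSpace H'] {I : ModelWithCorners ℝ E' H'} [TopologicalSpace M]
    [ChartedSpace H' M] [NormedAddCommGroup E₁] [NormedSpace ℝ E₁] [NormedAddCommGroup E₂]
    [NormedSpace ℝ E₂] {f : M → E₁} {g : M → E₂} {p : M} {f' : E' →L[ℝ] E₁} {g' : E' →L[ℝ] E₂}
    (hf : HasMFDerivAt I 𝓘(ℝ, E₁) f p f') (hg : HasMFDerivAt I 𝓘(ℝ, E₂) g p g') :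
    HasMFDerivAt I 𝓘(ℝ, E₁ × E₂) (fun q => (f q, g q)) p (f'.prod g') :=
  ⟨hf.1.prodMk hg.1, hf.2.prodMk hg.2⟩

theorem toV_conj {G V : Type*} [Group G] [NormedAddCommGroup V] [NormedSpace ℝ V]
    {ρ : G →* (V →L[ℝ] V)} (h k : SemidirectGroup ρ) :
    SemidirectGroup.toV ρ (h * k * h⁻¹) = h.2 + ρ h.1 (SemidirectGroup.toV ρ k) -
      ρ h.1 (ρ (SemidirectGroup.toG ρ k) (ρ h.1⁻¹ h.2)) := by
  change h.2 + ρ h.1 k.2 + ρ (h.1 * k.1) (-ρ h.1⁻¹ h.2) =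
    h.2 + ρ h.1 k.2 - ρ h.1 (ρ k.1 (ρ h.1⁻¹ h.2))
  rw [map_neg, rep_mul_apply, sub_eq_add_neg]

section SemidirectAlgebra

variable {E : Type*} [NormedAddCommGroup E] [NormedSpace ℝ E]
  {G : Type*} [Group G] [TopologicalSpace G] [ChartedSpace E G]
  {V : Type*} [NormedAddCommGroup V] [NormedSpace ℝ V]
  {ρ : G →* (V →L[ℝ] V)} {B : V →L[ℝ] V →L[ℝ] ℝ}

theorem hasMFDerivAt_toG (a : SemidirectGroup ρ) :
    HasMFDerivAt (semidirectModel E V) 𝓘(ℝ, E) (SemidirectGroup.toG ρ) a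
      (ContinuousLinearMap.fst ℝ E V) :=
  hasMFDerivAt_fst (I := 𝓘(ℝ, E)) (I' := 𝓘(ℝ, V)) (M := G) (M' := V) a

theorem hasMFDerivAt_toV (a : SemidirectGroup ρ) :
    HasMFDerivAt (semidirectModel E V) 𝓘(ℝ, V) (SemidirectGroup.toV ρ) a
      (ContinuousLinearMap.snd ℝ E V) :=
  hasMFDerivAt_snd (I := 𝓘(ℝ, E)) (I' := 𝓘(ℝ, V)) (M := G) (M' := V) a

theorem projG_apply (Z : E × V) : projG (E := E) ρ Z = Z.1 :=
  DFunLike.congr_fun (hasMFDerivAt_toG (E := E) (ρ := ρ) 1).mfderiv Z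

theorem projV_apply (Z : E × V) : projV (E := E) ρ Z = Z.2 :=
  DFunLike.congr_fun (hasMFDerivAt_toV (E := E) (ρ := ρ) 1).mfderiv Z

theorem dualPoint_apply (B : V →L[ℝ] V →L[ℝ] ℝ) (w : V) (α : E →L[ℝ] ℝ) (Z : E × V) :
    (dualPoint (E := E) ρ B w α : E × V →L[ℝ] ℝ) Z = α Z.1 + B w Z.2 := by
  rw [← projG_apply (ρ := ρ) Z, ← projV_apply (ρ := ρ) Z]
  rfl

theorem inner_infAct (hρ : ContMDiff 𝓘(ℝ, E) 𝓘(ℝ, V →L[ℝ] V) ∞ ρ) (hB : IsInvariantInner ρ B)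
    (w u : V) (X : E) : B w (infAct E ρ u X) = -B (infAct E ρ w X) u := by
  have hinner : HasMFDerivAt 𝓘(ℝ, V × V) 𝓘(ℝ, ℝ) (fun p : V × V => B p.1 p.2) (ρ 1 w, ρ 1 u)
      (B.deriv₂ (ρ 1 w, ρ 1 u)) :=
    (B.isBoundedBilinearMap.hasFDerivAt _).hasMFDerivAt
  have horbit := hasMFDerivAt_prodMk_space (hasMFDerivAt_rep_apply hρ w)
    (hasMFDerivAt_rep_apply hρ u)
  have hconst : ((fun p : V × V => B p.1 p.2) ∘ fun g : G => (ρ g w, ρ g u)) = fun _ => B w u :=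
    funext fun g => hB.invariant g w u
  have hcomp := hinner.comp (1 : G) horbit
  rw [hconst] at hcomp
  have hderiv : B (ρ 1 w) (infAct E ρ u X) + B (infAct E ρ w X) (ρ 1 u) = 0 :=
    DFunLike.congr_fun (hasMFDerivAt_unique hcomp (hasMFDerivAt_const (B w u) (1 : G))) X
  rw [rep_one_apply, rep_one_apply] at hderiv
  exact eq_neg_of_add_eq_zero_left hderiv

theorem momentMap_apply (hρ : ContMDiff 𝓘(ℝ, E) 𝓘(ℝ, V →L[ℝ] V) ∞ ρ) (w v : V) (X : E) :
    (momentMap (E := E) ρ B w v : E →L[ℝ] ℝ) X = B (infAct E ρ w X) v :=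
  congrArg (fun y => B y v) (DFunLike.congr_fun (infRep_eq_infAct hρ w) X)

theorem hasMFDerivAt_toV_conj (hρ : ContMDiff 𝓘(ℝ, E) 𝓘(ℝ, V →L[ℝ] V) ∞ ρ)
    (h : SemidirectGroup ρ) :
    HasMFDerivAt (semidirectModel E V) 𝓘(ℝ, V)
      (fun k : SemidirectGroup ρ => SemidirectGroup.toV ρ (h * k * h⁻¹)) 1
      ((ρ h.1).comp (ContinuousLinearMap.snd ℝ E V) -
        (ρ h.1).comp ((infAct E ρ (ρ h.1⁻¹ h.2)).comp (ContinuousLinearMap.fst ℝ E V))) := by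
  have haffine : HasMFDerivAt 𝓘(ℝ, V) 𝓘(ℝ, V) (fun v => h.2 + ρ h.1 v)
      (SemidirectGroup.toV ρ 1) (ρ h.1) :=
    ((ρ h.1).hasFDerivAt.const_add h.2).hasMFDerivAt
  have htranslate : HasMFDerivAt (semidirectModel E V) 𝓘(ℝ, V)
      (fun k : SemidirectGroup ρ => h.2 + ρ h.1 (SemidirectGroup.toV ρ k)) 1
      ((ρ h.1).comp (ContinuousLinearMap.snd ℝ E V)) :=
    haffine.comp (1 : SemidirectGroup ρ) (hasMFDerivAt_toV (E := E) (ρ := ρ) 1)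
  have horbit : HasMFDerivAt 𝓘(ℝ, E) 𝓘(ℝ, V) (fun g : G => ρ g (ρ h.1⁻¹ h.2))
      (SemidirectGroup.toG ρ 1) (infAct E ρ (ρ h.1⁻¹ h.2)) :=
    hasMFDerivAt_rep_apply hρ _
  have hrotate : HasMFDerivAt (semidirectModel E V) 𝓘(ℝ, V)
      (fun k : SemidirectGroup ρ => ρ h.1 (ρ (SemidirectGroup.toG ρ k) (ρ h.1⁻¹ h.2))) 1
      ((ρ h.1).comp ((infAct E ρ (ρ h.1⁻¹ h.2)).comp (ContinuousLinearMap.fst ℝ E V))) :=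
    (ρ h.1).hasMFDerivAt.comp (1 : SemidirectGroup ρ)
      (horbit.comp (1 : SemidirectGroup ρ) (hasMFDerivAt_toG (E := E) (ρ := ρ) 1))
  rw [funext (toV_conj h)]
  exact htranslate.sub hrotate

/-- The linear part `(T, v) ↦ ((w, s) ↦ (T w + s v, 0))` of the embedding of the affine
transformations of `V` into the linear endomorphisms of `V × ℝ`. -/
def affineLinearPart (V : Type*) [NormedAddCommGroup V] [NormedSpace ℝ V] :
    ((V →L[ℝ] V) × V) →L[ℝ] (V × ℝ →L[ℝ] V × ℝ) :=
  (ContinuousLinearMap.compL ℝ (V × ℝ) V (V × ℝ) (ContinuousLinearMap.inl ℝ V ℝ)).comp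
    (((ContinuousLinearMap.compL ℝ (V × ℝ) V V).flip (ContinuousLinearMap.fst ℝ V ℝ)).comp
        (ContinuousLinearMap.fst ℝ (V →L[ℝ] V) V) +
      (ContinuousLinearMap.smulRightL ℝ (V × ℝ) V (ContinuousLinearMap.snd ℝ V ℝ)).comp
        (ContinuousLinearMap.snd ℝ (V →L[ℝ] V) V))

/-- The representation `(g, v) ↦ ((w, s) ↦ (ρ(g) w + s v, s))` of `G ×_ρ V` on `V × ℝ`. It turns
brackets in `𝔤_ρ` into commutators of endomorphisms. -/
def affineRep (ρ : G →* (V →L[ℝ] V)) : SemidirectGroup ρ →* (V × ℝ →L[ℝ] V × ℝ) where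
  toFun a := affineLinearPart V (ρ a.1, a.2) +
    (ContinuousLinearMap.inr ℝ V ℝ).comp (ContinuousLinearMap.snd ℝ V ℝ)
  map_one' := by
    refine ContinuousLinearMap.ext fun y => ?_
    change (ρ 1 y.1 + y.2 • (0 : V), (0 : ℝ)) + ((0 : V), y.2) = y
    rw [rep_one_apply, smul_zero, add_zero, Prod.fst_add_snd]
  map_mul' a b := by
    refine ContinuousLinearMap.ext fun y => ?_
    change (ρ (a.1 * b.1) y.1 + y.2 • (a.2 + ρ a.1 b.2), (0 : ℝ)) + ((0 : V), y.2) =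
      (ρ a.1 (ρ b.1 y.1 + y.2 • b.2 + 0) + (0 + y.2) • a.2, (0 : ℝ)) + ((0 : V), 0 + y.2)
    rw [rep_mul_apply, add_zero, zero_add, map_add, map_smul, smul_add, add_assoc,
      add_comm (y.2 • a.2)]

theorem contMDiff_affineRep (hρ : ContMDiff 𝓘(ℝ, E) 𝓘(ℝ, V →L[ℝ] V) ∞ ρ) :
    ContMDiff (semidirectModel E V) 𝓘(ℝ, V × ℝ →L[ℝ] V × ℝ) ∞ (affineRep ρ) :=
  have htoG : ContMDiff (semidirectModel E V) 𝓘(ℝ, E) ∞ (SemidirectGroup.toG ρ) :=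
    contMDiff_fst (I := 𝓘(ℝ, E)) (J := 𝓘(ℝ, V)) (M := G) (N := V)
  have htoV : ContMDiff (semidirectModel E V) 𝓘(ℝ, V) ∞ (SemidirectGroup.toV ρ) :=
    contMDiff_snd (I := 𝓘(ℝ, E)) (J := 𝓘(ℝ, V)) (M := G) (N := V)
  ((affineLinearPart V).contDiff.add contDiff_const).contMDiff.comp
    ((hρ.comp htoG).prodMk_space htoV)

/-- The differential `(X, u) ↦ ((w, s) ↦ (ρ(X) w + s u, 0))` of `affineRep ρ` at the identity. -/
def infAffineRep (E : Type*) [NormedAddCommGroup E] [NormedSpace ℝ E] [ChartedSpace E G]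
    (ρ : G →* (V →L[ℝ] V)) : E × V →L[ℝ] (V × ℝ →L[ℝ] V × ℝ) :=
  (affineLinearPart V).comp
    (((infAct E ρ).flip.comp (ContinuousLinearMap.fst ℝ E V)).prod (ContinuousLinearMap.snd ℝ E V))

theorem infAffineRep_apply (Z : E × V) (y : V × ℝ) :
    infAffineRep E ρ Z y = (infAct E ρ y.1 Z.1 + y.2 • Z.2, 0) := rfl

theorem hasMFDerivAt_affineRep (hρ : ContMDiff 𝓘(ℝ, E) 𝓘(ℝ, V →L[ℝ] V) ∞ ρ) :
    HasMFDerivAt (semidirectModel E V) 𝓘(ℝ, V × ℝ →L[ℝ] V × ℝ) (affineRep ρ) 1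
      (infAffineRep E ρ) := by
  have hρ₁ : HasMFDerivAt 𝓘(ℝ, E) 𝓘(ℝ, V →L[ℝ] V) ρ (SemidirectGroup.toG ρ 1)
      (infAct E ρ).flip :=
    ((hρ 1).mdifferentiableAt (by simp)).hasMFDerivAt
  have hpair := hasMFDerivAt_prodMk_space
    (hρ₁.comp (1 : SemidirectGroup ρ) (hasMFDerivAt_toG (E := E) (ρ := ρ) 1))
    (hasMFDerivAt_toV (E := E) (ρ := ρ) 1)
  have hlin : HasMFDerivAt 𝓘(ℝ, (V →L[ℝ] V) × V) 𝓘(ℝ, V × ℝ →L[ℝ] V × ℝ)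
      (fun p : (V →L[ℝ] V) × V => affineLinearPart V p +
        (ContinuousLinearMap.inr ℝ V ℝ).comp (ContinuousLinearMap.snd ℝ V ℝ))
      (ρ (SemidirectGroup.toG ρ 1), SemidirectGroup.toV ρ 1) (affineLinearPart V) :=
    ((affineLinearPart V).hasFDerivAt.add_const _).hasMFDerivAt
  exact HasMFDerivAt.comp (f := fun a : SemidirectGroup ρ =>
    (ρ (SemidirectGroup.toG ρ a), SemidirectGroup.toV ρ a)) (1 : SemidirectGroup ρ) hlin hpair

/-- The Lie bracket of `𝔤_ρ`, as an operation on the underlying vector space `E × V`. -/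
def semidirectBracket (ρ : G →* (V →L[ℝ] V)) (X Y : E × V) : E × V :=
  let X' : GroupLieAlgebra (semidirectModel E V) (SemidirectGroup ρ) := X
  let Y' : GroupLieAlgebra (semidirectModel E V) (SemidirectGroup ρ) := Y
  (⁅X', Y'⁆ : GroupLieAlgebra (semidirectModel E V) (SemidirectGroup ρ))

theorem isCoad_iff_semidirectBracket (X : E × V) (ξ η : E × V →L[ℝ] ℝ) :
    IsCoad (J := semidirectModel E V) (L := SemidirectGroup ρ) X ξ η ↔
      ∀ Z, η Z = -ξ (semidirectBracket ρ X Z) :=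
  Iff.rfl

section LieGroup

variable [LieGroup 𝓘(ℝ, E) ∞ G]

theorem projV_Ad (hρ : ContMDiff 𝓘(ℝ, E) 𝓘(ℝ, V →L[ℝ] V) ∞ ρ) (h : SemidirectGroup ρ)
    (Z : E × V) :
    projV (E := E) ρ (Ad (semidirectModel E V) h Z) =
      ρ h.1 Z.2 - ρ h.1 (infAct E ρ (ρ h.1⁻¹ h.2) Z.1) := by
  have : LieGroup (semidirectModel E V) ∞ (SemidirectGroup ρ) := SemidirectGroup.lieGroup ρ hρ
  have hconj : HasMFDerivAt (semidirectModel E V) (semidirectModel E V)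
      (fun k : SemidirectGroup ρ => h * k * h⁻¹) 1 (Ad (semidirectModel E V) h) :=
    (((contMDiff_mul_right (I := semidirectModel E V) (n := ∞)).comp
      contMDiff_mul_left).mdifferentiableAt (by simp)).hasMFDerivAt
  have htoV : HasMFDerivAt (semidirectModel E V) 𝓘(ℝ, V) (SemidirectGroup.toV ρ) (h * 1 * h⁻¹)
      (projV (E := E) ρ) := by
    rw [mul_one, mul_inv_cancel]
    exact (hasMFDerivAt_toV 1).mdifferentiableAt.hasMFDerivAt
  exact DFunLike.congr_fun (hasMFDerivAt_unique (htoV.comp (1 : SemidirectGroup ρ) hconj)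
    (hasMFDerivAt_toV_conj hρ h)) Z

theorem coAd_inv_dualPoint (hρ : ContMDiff 𝓘(ℝ, E) 𝓘(ℝ, V →L[ℝ] V) ∞ ρ)
    (hB : IsInvariantInner ρ B) (x : V) (k : SemidirectGroup ρ) :
    coAd (semidirectModel E V) k⁻¹ (dualPoint (E := E) ρ B x 0) =
      dualPoint (E := E) ρ B (ρ k.1⁻¹ x) (momentMap ρ B (ρ k.1⁻¹ x) (ρ k.1⁻¹ k.2)) := by
  refine ContinuousLinearMap.ext fun Z : E × V => ?_
  have hcoAd : coAd (semidirectModel E V) k⁻¹ (dualPoint (E := E) ρ B x 0) Z =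
      B x (projV (E := E) ρ (Ad (semidirectModel E V) k Z)) := by
    conv_rhs => rw [← inv_inv k]
    exact zero_add (B x (projV (E := E) ρ (Ad (semidirectModel E V) (k⁻¹)⁻¹ Z)))
  have hinv (y : V) : B x (ρ k.1 y) = B (ρ k.1⁻¹ x) y := by
    rw [← hB.invariant k.1 (ρ k.1⁻¹ x) y, rep_apply_inv]
  refine (hcoAd.trans ?_).trans (dualPoint_apply (E := E) (ρ := ρ) B (ρ k.1⁻¹ x) _ Z).symm
  rw [projV_Ad hρ, map_sub, hinv, hinv, inner_infAct hρ hB, sub_neg_eq_add, add_comm]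
  exact congrArg (· + B (ρ k.1⁻¹ x) Z.2) (momentMap_apply hρ _ _ Z.1).symm

theorem mem_semidirectOrbit_iff (hρ : ContMDiff 𝓘(ℝ, E) 𝓘(ℝ, V →L[ℝ] V) ∞ ρ)
    (hB : IsInvariantInner ρ B) (x : V)
    (ξ : DualLieAlgebra (semidirectModel E V) (SemidirectGroup ρ)) :
    ξ ∈ semidirectOrbit E ρ B x ↔
      ∃ w ∈ repOrbit ρ x, ∃ v, ξ = dualPoint (E := E) ρ B w (momentMap ρ B w v) := by
  constructor
  · rintro ⟨h, rfl⟩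
    exact ⟨_, ⟨_, rfl⟩, _, inv_inv h ▸ coAd_inv_dualPoint hρ hB x h⁻¹⟩
  · rintro ⟨_, ⟨g, rfl⟩, v, rfl⟩
    let k : SemidirectGroup ρ := (g⁻¹, ρ g⁻¹ v)
    refine ⟨k⁻¹, (coAd_inv_dualPoint hρ hB x k).trans ?_⟩
    change dualPoint (E := E) ρ B (ρ g⁻¹⁻¹ x) (momentMap ρ B (ρ g⁻¹⁻¹ x) (ρ g⁻¹⁻¹ (ρ g⁻¹ v))) = _
    rw [inv_inv, rep_apply_inv]

section Bracket

variable [FiniteDimensional ℝ E] [FiniteDimensional ℝ V]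

theorem infAffineRep_semidirectBracket (hρ : ContMDiff 𝓘(ℝ, E) 𝓘(ℝ, V →L[ℝ] V) ∞ ρ)
    (X Y : E × V) (y : V × ℝ) :
    infAffineRep E ρ (semidirectBracket ρ X Y) y =
      infAffineRep E ρ X (infAffineRep E ρ Y y) - infAffineRep E ρ Y (infAffineRep E ρ X y) := by
  have : LieGroup (semidirectModel E V) ∞ (SemidirectGroup ρ) := SemidirectGroup.lieGroup ρ hρ
  have : CompleteSpace (E × V) := FiniteDimensional.complete ℝ (E × V)
  exact DFunLike.congr_fun
    (mfderiv_rep_bracket (contMDiff_affineRep hρ) (hasMFDerivAt_affineRep hρ) X Y) y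

theorem snd_semidirectBracket (hρ : ContMDiff 𝓘(ℝ, E) 𝓘(ℝ, V →L[ℝ] V) ∞ ρ) (X Y : E × V) :
    (semidirectBracket ρ X Y).2 = infAct E ρ Y.2 X.1 - infAct E ρ X.2 Y.1 := by
  simpa [infAffineRep_apply] using
    congrArg Prod.fst (infAffineRep_semidirectBracket hρ X Y (0, 1))

theorem infAct_semidirectBracket (hρ : ContMDiff 𝓘(ℝ, E) 𝓘(ℝ, V →L[ℝ] V) ∞ ρ) (X Y : E × V)
    (w : V) :
    infAct E ρ w (semidirectBracket ρ X Y).1 =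
      infAct E ρ (infAct E ρ w Y.1) X.1 - infAct E ρ (infAct E ρ w X.1) Y.1 := by
  simpa [infAffineRep_apply] using
    congrArg Prod.fst (infAffineRep_semidirectBracket hρ X Y (w, 0))

end Bracket

end LieGroup

end SemidirectAlgebra

/-! ### Cotangent coordinates on the coadjoint orbit -/

section FiberPoint

variable {E : Type*} [NormedAddCommGroup E] [NormedSpace ℝ E]
  {G : Type*} [Group G] [TopologicalSpace G] [ChartedSpace E G]
  {V : Type*} [NormedAddCommGroup V] [NormedSpace ℝ V]
  {ρ : G →* (V →L[ℝ] V)} {B : V →L[ℝ] V →L[ℝ] ℝ}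
  {A : Type*} [NormedAddCommGroup A] [NormedSpace ℝ A] {x : V}

variable (E B) in
/-- The functional `w + α` with cotangent coordinates `(t, q)`, with respect to a parametrization
of the orbit of `x`: here `w` is the point with parameter `t`, and `α` is the pullback under
`X ↦ ρ(X) w` of the covector at `w` with components `q`. -/
def fiberPoint (c : GraphChart A (repOrbit ρ x)) (y : A × (A →L[ℝ] ℝ)) : E × V →L[ℝ] ℝ :=
  (y.2.comp (c.proj.comp (infAct E ρ (c.sec y.1)))).comp (ContinuousLinearMap.fst ℝ E V) +
    (B (c.sec y.1)).comp (ContinuousLinearMap.snd ℝ E V)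

theorem fiberPoint_apply (c : GraphChart A (repOrbit ρ x)) (y : A × (A →L[ℝ] ℝ)) (Z : E × V) :
    fiberPoint E B c y Z =
      y.2 (c.proj (infAct E ρ (c.sec y.1) Z.1)) + B (c.sec y.1) Z.2 := rfl

theorem contDiffOn_fiberPoint (c : GraphChart A (repOrbit ρ x)) :
    ContDiffOn ℝ ∞ (fiberPoint E B c) (c.param ×ˢ Set.univ) := by
  have hsec : ContDiffOn ℝ ∞ (fun y : A × (A →L[ℝ] ℝ) => c.sec y.1) (c.param ×ˢ Set.univ) :=
    c.contDiffOn_sec.comp contDiff_fst.contDiffOn fun y hy => hy.1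
  exact ((contDiff_snd.contDiffOn.clm_comp (contDiffOn_const.clm_comp
    ((infAct E ρ).contDiff.comp_contDiffOn hsec))).clm_comp contDiffOn_const).add
    ((B.contDiff.comp_contDiffOn hsec).clm_comp contDiffOn_const)

theorem hasFDerivAt_fiberPoint (c : GraphChart A (repOrbit ρ x)) {y : A × (A →L[ℝ] ℝ)}
    (hy : y.1 ∈ c.param) :
    HasFDerivAt (fiberPoint E B c) (fderiv ℝ (fiberPoint E B c) y) y :=
  ((contDiffOn_fiberPoint (E := E) c).contDiffAt
    ((c.isOpen_param.prod isOpen_univ).mem_nhds ⟨hy, trivial⟩)).differentiableAt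
    (by simp) |>.hasFDerivAt

theorem fderiv_fiberPoint_apply (c : GraphChart A (repOrbit ρ x)) {y : A × (A →L[ℝ] ℝ)}
    (hy : y.1 ∈ c.param) (a : A × (A →L[ℝ] ℝ)) (Z : E × V) :
    fderiv ℝ (fiberPoint E B c) y a Z =
      a.2 (c.proj (infAct E ρ (c.sec y.1) Z.1)) +
        y.2 (c.proj (infAct E ρ (fderiv ℝ c.sec y.1 a.1) Z.1)) +
      B (fderiv ℝ c.sec y.1 a.1) Z.2 := by
  have hsec : HasFDerivAt (fun y : A × (A →L[ℝ] ℝ) => c.sec y.1)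
      ((fderiv ℝ c.sec y.1).comp (ContinuousLinearMap.fst ℝ A (A →L[ℝ] ℝ))) y :=
    (c.hasFDerivAt_sec hy).comp y hasFDerivAt_fst
  have hproduct := (hasFDerivAt_snd.clm_apply
    ((c.proj.comp ((infAct E ρ).flip Z.1)).hasFDerivAt.comp y hsec)).add
    ((B.flip Z.2).hasFDerivAt.comp y hsec)
  have heval := (hasFDerivAt_fiberPoint (E := E) (B := B) c hy).clm_apply (hasFDerivAt_const Z y)
  simpa [add_comm, add_left_comm] using DFunLike.congr_fun (heval.unique hproduct) a

theorem dualPoint_momentMap_eq_fiberPoint (hρ : ContMDiff 𝓘(ℝ, E) 𝓘(ℝ, V →L[ℝ] V) ∞ ρ)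
    (hB : IsInvariantInner ρ B) (c : GraphChart A (repOrbit ρ x)) {w : V}
    (hw : w ∈ repOrbit ρ x) (hwc : w ∈ c.dom) (v : V) :
    (dualPoint (E := E) ρ B w (momentMap ρ B w v) : E × V →L[ℝ] ℝ) =
      fiberPoint E B c (c.proj w, (B v).comp (fderiv ℝ c.sec (c.proj w))) := by
  refine ContinuousLinearMap.ext fun Z =>
    (dualPoint_apply (E := E) (ρ := ρ) B w _ Z).trans ?_
  rw [fiberPoint_apply, c.sec_proj hw hwc]
  refine congrArg (· + B w Z.2) ((momentMap_apply hρ _ _ _).trans ?_)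
  rw [hB.symm]
  exact congrArg (B v) (DFunLike.congr_fun (infAct_eq_fderiv_sec_comp hρ c hw hwc) Z.1)

section BasePoint

variable [FiniteDimensional ℝ V]

/-- The point `w ∈ V` of the functional `w + α`. -/
def IsInvariantInner.basePoint (E : Type*) [NormedAddCommGroup E] [NormedSpace ℝ E]
    (hB : IsInvariantInner ρ B) : (E × V →L[ℝ] ℝ) →L[ℝ] V :=
  (hB.toDual.symm : (V →L[ℝ] ℝ) →L[ℝ] V).comp
    ((ContinuousLinearMap.compL ℝ V (E × V) ℝ).flip (ContinuousLinearMap.inr ℝ E V))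

theorem basePoint_dualPoint (hB : IsInvariantInner ρ B) (w : V) (α : E →L[ℝ] ℝ) :
    hB.basePoint E (dualPoint (E := E) ρ B w α) = w := by
  have hinr : (dualPoint (E := E) ρ B w α : E × V →L[ℝ] ℝ).comp
      (ContinuousLinearMap.inr ℝ E V) = B w :=
    ContinuousLinearMap.ext fun u => by simpa using dualPoint_apply (ρ := ρ) B w α ((0 : E), u)
  exact (congrArg hB.toDual.symm hinr).trans (hB.toDual_symm_apply w)

theorem basePoint_mem_repOrbit [LieGroup 𝓘(ℝ, E) ∞ G]
    (hρ : ContMDiff 𝓘(ℝ, E) 𝓘(ℝ, V →L[ℝ] V) ∞ ρ) (hB : IsInvariantInner ρ B)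
    {ξ : E × V →L[ℝ] ℝ} (hξ : ξ ∈ semidirectOrbit E ρ B x) :
    hB.basePoint E ξ ∈ repOrbit ρ x := by
  obtain ⟨w, hw, v, hwv⟩ := (mem_semidirectOrbit_iff hρ hB x ξ).1 hξ
  rwa [(congrArg (hB.basePoint E) hwv).trans (basePoint_dualPoint hB w _)]

theorem exists_fiberPoint_eq [LieGroup 𝓘(ℝ, E) ∞ G]
    (hρ : ContMDiff 𝓘(ℝ, E) 𝓘(ℝ, V →L[ℝ] V) ∞ ρ) (hB : IsInvariantInner ρ B)
    (c : GraphChart A (repOrbit ρ x)) {ξ : E × V →L[ℝ] ℝ} (hξ : ξ ∈ semidirectOrbit E ρ B x)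
    (hξc : hB.basePoint E ξ ∈ c.dom) : ∃ y, y.1 ∈ c.param ∧ fiberPoint E B c y = ξ := by
  obtain ⟨w, hw, v, hwv⟩ := (mem_semidirectOrbit_iff hρ hB x ξ).1 hξ
  rw [(congrArg (hB.basePoint E) hwv).trans (basePoint_dualPoint hB w _)] at hξc
  exact ⟨_, c.proj_mem_param hw hξc,
    (dualPoint_momentMap_eq_fiberPoint hρ hB c hw hξc v).symm.trans hwv.symm⟩

theorem fiberPoint_eq_dualPoint (hρ : ContMDiff 𝓘(ℝ, E) 𝓘(ℝ, V →L[ℝ] V) ∞ ρ)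
    (hB : IsInvariantInner ρ B) (c : GraphChart A (repOrbit ρ x)) (y : A × (A →L[ℝ] ℝ)) :
    fiberPoint E B c y = dualPoint (E := E) ρ B (c.sec y.1)
      (momentMap ρ B (c.sec y.1) (hB.toDual.symm (y.2.comp c.proj))) := by
  refine ContinuousLinearMap.ext fun Z =>
    Eq.trans ?_ (dualPoint_apply (E := E) (ρ := ρ) B (c.sec y.1) _ Z).symm
  refine congrArg (· + B (c.sec y.1) Z.2) (Eq.trans ?_ (momentMap_apply hρ _ _ _).symm)
  rw [hB.symm, hB.apply_toDual_symm]
  rfl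

theorem basePoint_fiberPoint (hB : IsInvariantInner ρ B) (c : GraphChart A (repOrbit ρ x))
    (y : A × (A →L[ℝ] ℝ)) : hB.basePoint E (fiberPoint E B c y) = c.sec y.1 := by
  have hinr : (fiberPoint E B c y).comp (ContinuousLinearMap.inr ℝ E V) = B (c.sec y.1) :=
    ContinuousLinearMap.ext fun u => by simp [fiberPoint_apply]
  exact (congrArg hB.toDual.symm hinr).trans (hB.toDual_symm_apply _)

theorem fiberPoint_mem_semidirectOrbit [LieGroup 𝓘(ℝ, E) ∞ G]
    (hρ : ContMDiff 𝓘(ℝ, E) 𝓘(ℝ, V →L[ℝ] V) ∞ ρ) (hB : IsInvariantInner ρ B)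
    (c : GraphChart A (repOrbit ρ x)) {y : A × (A →L[ℝ] ℝ)} (hy : y.1 ∈ c.param) :
    fiberPoint E B c y ∈ semidirectOrbit E ρ B x :=
  (mem_semidirectOrbit_iff hρ hB x _).2 ⟨_, c.sec_mem hy, _, fiberPoint_eq_dualPoint hρ hB c y⟩

end BasePoint

section Bracket

variable [FiniteDimensional ℝ E] [FiniteDimensional ℝ V] [LieGroup 𝓘(ℝ, E) ∞ G]

theorem isCoad_fderiv_fiberPoint (hρ : ContMDiff 𝓘(ℝ, E) 𝓘(ℝ, V →L[ℝ] V) ∞ ρ)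
    (hB : IsInvariantInner ρ B) (c : GraphChart A (repOrbit ρ x)) {y a : A × (A →L[ℝ] ℝ)}
    (hy : y.1 ∈ c.param) {X : E × V} (hX₁ : infAct E ρ (c.sec y.1) X.1 = fderiv ℝ c.sec y.1 a.1)
    (hX₂ : ∀ v, B X.2 v = -(a.2 (c.proj v) + y.2 (c.proj (infAct E ρ v X.1)))) :
    IsCoad (J := semidirectModel E V) (L := SemidirectGroup ρ) X
      (fiberPoint E B c y) (fderiv ℝ (fiberPoint E B c) y a) := by
  refine (isCoad_iff_semidirectBracket X _ _).2 fun Z => ?_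
  rw [fderiv_fiberPoint_apply c hy, fiberPoint_apply, infAct_semidirectBracket hρ,
    snd_semidirectBracket hρ, ← hX₁, map_sub, map_sub, map_sub, inner_infAct hρ hB _ Z.2,
    inner_infAct hρ hB _ X.2, hB.symm _ X.2, hX₂]
  ring

theorem exists_isCoad_fderiv_fiberPoint [FiniteDimensional ℝ A]
    (hρ : ContMDiff 𝓘(ℝ, E) 𝓘(ℝ, V →L[ℝ] V) ∞ ρ) (hB : IsInvariantInner ρ B)
    (hA : Module.finrank ℝ (infAct E ρ x).range = Module.finrank ℝ A)
    (c : GraphChart A (repOrbit ρ x)) {y : A × (A →L[ℝ] ℝ)} (hy : y.1 ∈ c.param)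
    (a : A × (A →L[ℝ] ℝ)) :
    ∃ X : E × V, infAct E ρ (c.sec y.1) X.1 = fderiv ℝ c.sec y.1 a.1 ∧
      (∀ v, B X.2 v = -(a.2 (c.proj v) + y.2 (c.proj (infAct E ρ v X.1)))) ∧
      IsCoad (J := semidirectModel E V) (L := SemidirectGroup ρ) X
        (fiberPoint E B c y) (fderiv ℝ (fiberPoint E B c) y a) := by
  have hw := c.sec_mem hy
  have hwc := c.sec_mem_dom hy
  obtain ⟨X₁, hX₁⟩ := surjective_proj_comp_infAct hρ hA c hw hwc a.1
  have hX₁' : infAct E ρ (c.sec y.1) X₁ = fderiv ℝ c.sec y.1 a.1 := by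
    rw [infAct_eq_fderiv_sec_comp hρ c hw hwc, ContinuousLinearMap.comp_apply, hX₁, c.proj_sec hy]
  let f : V →L[ℝ] ℝ := -(a.2.comp c.proj + y.2.comp (c.proj.comp ((infAct E ρ).flip X₁)))
  have hX₂ (v : V) : B (hB.toDual.symm f) v =
      -(a.2 (c.proj v) + y.2 (c.proj (infAct E ρ v X₁))) :=
    DFunLike.congr_fun (hB.apply_toDual_symm f) v
  exact ⟨(X₁, hB.toDual.symm f), hX₁', hX₂, isCoad_fderiv_fiberPoint hρ hB c hy hX₁' hX₂⟩

theorem exists_fiberPoint_semidirectBracket_eq [FiniteDimensional ℝ A]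
    (hρ : ContMDiff 𝓘(ℝ, E) 𝓘(ℝ, V →L[ℝ] V) ∞ ρ) (hB : IsInvariantInner ρ B)
    (hA : Module.finrank ℝ (infAct E ρ x).range = Module.finrank ℝ A)
    (c : GraphChart A (repOrbit ρ x)) {y : A × (A →L[ℝ] ℝ)} (hy : y.1 ∈ c.param)
    (a b : A × (A →L[ℝ] ℝ)) :
    ∃ X Y : E × V,
      IsCoad (J := semidirectModel E V) (L := SemidirectGroup ρ) X
        (fiberPoint E B c y) (fderiv ℝ (fiberPoint E B c) y a) ∧
      IsCoad (J := semidirectModel E V) (L := SemidirectGroup ρ) Y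
        (fiberPoint E B c y) (fderiv ℝ (fiberPoint E B c) y b) ∧
      fiberPoint E B c y (semidirectBracket ρ X Y) = b.2 a.1 - a.2 b.1 := by
  obtain ⟨X, -, -, hX⟩ := exists_isCoad_fderiv_fiberPoint hρ hB hA c hy a
  obtain ⟨Y, hY₁, hY₂, hY⟩ := exists_isCoad_fderiv_fiberPoint hρ hB hA c hy b
  refine ⟨X, Y, hX, hY, ?_⟩
  have hcoad := (isCoad_iff_semidirectBracket X _ _).1 hX Y
  rw [fderiv_fiberPoint_apply c hy, hB.symm _ Y.2, hY₂, hY₁, c.proj_fderiv_sec hy,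
    c.proj_fderiv_sec hy] at hcoad
  linarith

end Bracket

end FiberPoint

section FrameCoordinates

variable {E : Type*} [NormedAddCommGroup E] [NormedSpace ℝ E]
  {G : Type*} [Group G] [TopologicalSpace G] [ChartedSpace E G]
  {V : Type*} [NormedAddCommGroup V] [NormedSpace ℝ V]
  {ρ : G →* (V →L[ℝ] V)} {B : V →L[ℝ] V →L[ℝ] ℝ}
  {A : Type*} [NormedAddCommGroup A] [NormedSpace ℝ A] {x : V}

variable (E) in
/-- The tangent vectors `ρ(σ a) w` to the orbit, for `a ∈ A`, in the coordinates of a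
parametrization of the orbit; `t` is the parameter of `w`. -/
def actionFrame (c : GraphChart A (repOrbit ρ x)) (σ : A →L[ℝ] E) (t : A) : A →L[ℝ] A :=
  (c.proj.comp (infAct E ρ (c.sec t))).comp σ

variable (E) in
/-- The parameters of the points of the orbit at which the vectors `ρ(σ a) w` span the tangent
space. -/
def frameDomain (c : GraphChart A (repOrbit ρ x)) (σ : A →L[ℝ] E) : Set A :=
  c.param ∩ actionFrame E c σ ⁻¹' {T | T.IsInvertible}

variable (E) in
/-- The passage from the components of a covector in the frame `ρ(σ a) w` to its cotangent
coordinates. -/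
def frameToCotangent (c : GraphChart A (repOrbit ρ x)) (σ : A →L[ℝ] E) (y : A × (A →L[ℝ] ℝ)) :
    A × (A →L[ℝ] ℝ) :=
  (y.1, y.2.comp (actionFrame E c σ y.1).inverse)

theorem contDiffOn_actionFrame (c : GraphChart A (repOrbit ρ x)) (σ : A →L[ℝ] E) :
    ContDiffOn ℝ ∞ (actionFrame E c σ) c.param :=
  (contDiffOn_const.clm_comp
    ((infAct E ρ).contDiff.comp_contDiffOn c.contDiffOn_sec)).clm_comp contDiffOn_const

theorem isOpen_frameDomain [CompleteSpace A] (c : GraphChart A (repOrbit ρ x)) (σ : A →L[ℝ] E) :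
    IsOpen (frameDomain E c σ) :=
  (contDiffOn_actionFrame c σ).continuousOn.isOpen_inter_preimage c.isOpen_param
    ContinuousLinearEquiv.isOpen

theorem contDiffOn_frameToCotangent [CompleteSpace A] (c : GraphChart A (repOrbit ρ x))
    (σ : A →L[ℝ] E) :
    ContDiffOn ℝ ∞ (frameToCotangent E c σ) (frameDomain E c σ ×ˢ Set.univ) := by
  have hinverse : ContDiffOn ℝ ∞ (fun t => (actionFrame E c σ t).inverse) (frameDomain E c σ) :=
    fun t ht => (ht.2.contDiffAt_map_inverse.comp t
      ((contDiffOn_actionFrame c σ).contDiffAt (c.isOpen_param.mem_nhds ht.1))).contDiffWithinAt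
  exact contDiff_fst.contDiffOn.prodMk (contDiff_snd.contDiffOn.clm_comp
    (hinverse.comp contDiff_fst.contDiffOn fun _ hy => hy.1))

theorem proj_mem_frameDomain (c : GraphChart A (repOrbit ρ x)) {w : V} (hw : w ∈ repOrbit ρ x)
    (hwc : w ∈ c.dom) {σ : A →L[ℝ] E} (hσ : Function.RightInverse σ (c.proj.comp (infAct E ρ w))) :
    c.proj w ∈ frameDomain E c σ := by
  refine ⟨c.proj_mem_param hw hwc, ContinuousLinearEquiv.refl ℝ A, ?_⟩
  refine ContinuousLinearMap.ext fun a => ?_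
  change a = c.proj (infAct E ρ (c.sec (c.proj w)) (σ a))
  rw [c.sec_proj hw hwc]
  exact (hσ a).symm

variable [FiniteDimensional ℝ V]

/-- The coordinates of `w + α` given by the parameter of `w` and the components `α(σ a)` of `α`.
In contrast to the cotangent coordinates, they extend to a linear map on all functionals. -/
def frameCoord (hB : IsInvariantInner ρ B) (c : GraphChart A (repOrbit ρ x)) (σ : A →L[ℝ] E) :
    (E × V →L[ℝ] ℝ) →L[ℝ] A × (A →L[ℝ] ℝ) :=
  (c.proj.comp (hB.basePoint E)).prod ((ContinuousLinearMap.compL ℝ A (E × V) ℝ).flip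
    ((ContinuousLinearMap.inl ℝ E V).comp σ))

theorem frameCoord_fiberPoint (hB : IsInvariantInner ρ B) (c : GraphChart A (repOrbit ρ x))
    (σ : A →L[ℝ] E) {y : A × (A →L[ℝ] ℝ)} (hy : y.1 ∈ c.param) :
    frameCoord hB c σ (fiberPoint E B c y) = (y.1, y.2.comp (actionFrame E c σ y.1)) := by
  refine Prod.ext ?_ (ContinuousLinearMap.ext fun a => ?_)
  · change c.proj (hB.basePoint E (fiberPoint E B c y)) = y.1
    rw [basePoint_fiberPoint, c.proj_sec hy]
  · change fiberPoint E B c y (σ a, 0) = y.2 (actionFrame E c σ y.1 a)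
    rw [fiberPoint_apply, map_zero, add_zero]
    rfl

theorem frameCoord_fiberPoint_frameToCotangent (hB : IsInvariantInner ρ B)
    (c : GraphChart A (repOrbit ρ x)) (σ : A →L[ℝ] E) {y : A × (A →L[ℝ] ℝ)}
    (hy : y.1 ∈ frameDomain E c σ) :
    frameCoord hB c σ (fiberPoint E B c (frameToCotangent E c σ y)) = y := by
  refine (frameCoord_fiberPoint (y := frameToCotangent E c σ y) hB c σ hy.1).trans
    (Prod.ext rfl ?_)
  change (y.2.comp (actionFrame E c σ y.1).inverse).comp (actionFrame E c σ y.1) = y.2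
  rw [ContinuousLinearMap.comp_assoc, hy.2.inverse_comp_self, ContinuousLinearMap.comp_id]

variable [LieGroup 𝓘(ℝ, E) ∞ G]

theorem fiberPoint_frameToCotangent_frameCoord (hρ : ContMDiff 𝓘(ℝ, E) 𝓘(ℝ, V →L[ℝ] V) ∞ ρ)
    (hB : IsInvariantInner ρ B) (c : GraphChart A (repOrbit ρ x)) (σ : A →L[ℝ] E)
    {ξ : E × V →L[ℝ] ℝ} (hξ : ξ ∈ semidirectOrbit E ρ B x) (hξc : hB.basePoint E ξ ∈ c.dom)
    (hξσ : c.proj (hB.basePoint E ξ) ∈ frameDomain E c σ) :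
    fiberPoint E B c (frameToCotangent E c σ (frameCoord hB c σ ξ)) = ξ := by
  obtain ⟨y, hy, rfl⟩ := exists_fiberPoint_eq hρ hB c hξ hξc
  rw [basePoint_fiberPoint, c.proj_sec hy] at hξσ
  rw [frameCoord_fiberPoint hB c σ hy, frameToCotangent, ContinuousLinearMap.comp_assoc,
    hξσ.2.self_comp_inverse, ContinuousLinearMap.comp_id]

variable [CompleteSpace A]

/-- The presentation of the coadjoint orbit as a graph given by the frame coordinates. -/
def semidirectOrbitGraphChart (hρ : ContMDiff 𝓘(ℝ, E) 𝓘(ℝ, V →L[ℝ] V) ∞ ρ)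
    (hB : IsInvariantInner ρ B) (c : GraphChart A (repOrbit ρ x)) (σ : A →L[ℝ] E) :
    GraphChart (A × (A →L[ℝ] ℝ)) (semidirectOrbit E ρ B x) where
  dom := hB.basePoint E ⁻¹' (c.dom ∩ c.proj ⁻¹' frameDomain E c σ)
  param := frameDomain E c σ ×ˢ Set.univ
  proj := frameCoord hB c σ
  sec y := fiberPoint E B c (frameToCotangent E c σ y)
  isOpen_dom := (c.isOpen_dom.inter ((isOpen_frameDomain c σ).preimage
    c.proj.continuous)).preimage (hB.basePoint E).continuous
  isOpen_param := (isOpen_frameDomain c σ).prod isOpen_univ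
  contDiffOn_sec := (contDiffOn_fiberPoint c).comp (contDiffOn_frameToCotangent c σ)
    fun _ hy => ⟨hy.1.1, trivial⟩
  image_sec := by
    refine Set.Subset.antisymm ?_ fun ξ hξ =>
      ⟨frameCoord hB c σ ξ, ⟨hξ.2.2, trivial⟩,
        fiberPoint_frameToCotangent_frameCoord hρ hB c σ hξ.1 hξ.2.1 hξ.2.2⟩
    rintro _ ⟨y, ⟨hy, -⟩, rfl⟩
    refine ⟨fiberPoint_mem_semidirectOrbit hρ hB c hy.1, ?_⟩
    rw [Set.mem_preimage, basePoint_fiberPoint]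
    exact ⟨c.sec_mem_dom hy.1, by rwa [Set.mem_preimage, frameToCotangent, c.proj_sec hy.1]⟩
  proj_sec _ hy := frameCoord_fiberPoint_frameToCotangent hB c σ hy.1

end FrameCoordinates

section LocalCharts

variable {E : Type*} [NormedAddCommGroup E] [NormedSpace ℝ E]
  {G : Type*} [Group G] [TopologicalSpace G] [ChartedSpace E G] [LieGroup 𝓘(ℝ, E) ∞ G]
  {V : Type*} [NormedAddCommGroup V] [NormedSpace ℝ V] [FiniteDimensional ℝ V]
  {ρ : G →* (V →L[ℝ] V)} {B : V →L[ℝ] V →L[ℝ] ℝ}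
  {A : Type*} [NormedAddCommGroup A] [NormedSpace ℝ A] [FiniteDimensional ℝ A] {x : V}

theorem exists_basePoint_proj_mem_frameDomain (hρ : ContMDiff 𝓘(ℝ, E) 𝓘(ℝ, V →L[ℝ] V) ∞ ρ)
    (hB : IsInvariantInner ρ B)
    (hA : Module.finrank ℝ (infAct E ρ x).range = Module.finrank ℝ A)
    (c : GraphChart A (repOrbit ρ x)) {ξ : E × V →L[ℝ] ℝ} (hξ : ξ ∈ semidirectOrbit E ρ B x)
    (hξc : hB.basePoint E ξ ∈ c.dom) :
    ∃ σ : A →L[ℝ] E, c.proj (hB.basePoint E ξ) ∈ frameDomain E c σ := by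
  have hw := basePoint_mem_repOrbit hρ hB hξ
  obtain ⟨σ, hσ⟩ := (c.proj.comp (infAct E ρ _)).exists_rightInverse_of_surjective
    (LinearMap.range_eq_top.2 (surjective_proj_comp_infAct hρ hA c hw hξc))
  exact ⟨σ, proj_mem_frameDomain c hw hξc (DFunLike.congr_fun hσ)⟩

theorem exists_graphChart_semidirectOrbit (hρ : ContMDiff 𝓘(ℝ, E) 𝓘(ℝ, V →L[ℝ] V) ∞ ρ)
    (hB : IsInvariantInner ρ B)
    (hA : Module.finrank ℝ (infAct E ρ x).range = Module.finrank ℝ A)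
    {A' : Type*} [NormedAddCommGroup A'] [NormedSpace ℝ A'] (K : (A × (A →L[ℝ] ℝ)) ≃L[ℝ] A')
    (c : GraphChart A (repOrbit ρ x)) {ξ : E × V →L[ℝ] ℝ} (hξ : ξ ∈ semidirectOrbit E ρ B x)
    (hξc : hB.basePoint E ξ ∈ c.dom) :
    ∃ d : GraphChart A' (semidirectOrbit E ρ B x), ξ ∈ d.dom := by
  have : CompleteSpace A := FiniteDimensional.complete ℝ A
  obtain ⟨σ, hσ⟩ := exists_basePoint_proj_mem_frameDomain hρ hB hA c hξ hξc
  exact ⟨(semidirectOrbitGraphChart hρ hB c σ).reparam K, hξc, hσ⟩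

theorem exists_contDiffAt_fiberPoint_eq (hρ : ContMDiff 𝓘(ℝ, E) 𝓘(ℝ, V →L[ℝ] V) ∞ ρ)
    (hB : IsInvariantInner ρ B)
    (hA : Module.finrank ℝ (infAct E ρ x).range = Module.finrank ℝ A)
    (c : GraphChart A (repOrbit ρ x)) {ξ : E × V →L[ℝ] ℝ} (hξ : ξ ∈ semidirectOrbit E ρ B x)
    (hξc : hB.basePoint E ξ ∈ c.dom) :
    ∃ κ : (E × V →L[ℝ] ℝ) → A × (A →L[ℝ] ℝ), ContDiffAt ℝ ∞ κ ξ ∧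
      ∀ᶠ η in 𝓝 ξ, η ∈ semidirectOrbit E ρ B x →
        (κ η).1 ∈ c.param ∧ fiberPoint E B c (κ η) = η := by
  have : CompleteSpace A := FiniteDimensional.complete ℝ A
  obtain ⟨σ, hσ⟩ := exists_basePoint_proj_mem_frameDomain hρ hB hA c hξ hξc
  let d := semidirectOrbitGraphChart hρ hB c σ
  refine ⟨fun η => frameToCotangent E c σ (frameCoord hB c σ η), ?_, ?_⟩
  · exact ((contDiffOn_frameToCotangent c σ).contDiffAt
      (d.isOpen_param.mem_nhds ⟨hσ, trivial⟩)).comp ξ (frameCoord hB c σ).contDiff.contDiffAt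
  · filter_upwards [d.isOpen_dom.mem_nhds ⟨hξc, hσ⟩] with η hηd hη
    exact ⟨hηd.2.1, fiberPoint_frameToCotangent_frameCoord hρ hB c σ hη hηd.1 hηd.2⟩

end LocalCharts

/-! ### The fibres of the coadjoint orbit -/

section RangeEquiv

variable {R M N P : Type*} [Ring R] [AddCommGroup M] [Module R M] [AddCommGroup N] [Module R N]
  [AddCommGroup P] [Module R P]

/-- The isomorphism `f(v) ↦ g(v)` from the range of `f` to the target of `g`, for two linear maps
with the same kernel of which `g` is surjective. -/
def rangeEquivOfKerEq (f : M →ₗ[R] N) (g : M →ₗ[R] P) (hker : f.ker = g.ker)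
    (hg : Function.Surjective g) : f.range ≃ₗ[R] P :=
  f.quotKerEquivRange.symm ≪≫ₗ Submodule.quotEquivOfEq _ _ hker ≪≫ₗ
    g.quotKerEquivOfSurjective hg

theorem rangeEquivOfKerEq_apply (f : M →ₗ[R] N) (g : M →ₗ[R] P) (hker : f.ker = g.ker)
    (hg : Function.Surjective g) (v : M) :
    rangeEquivOfKerEq f g hker hg ⟨f v, v, rfl⟩ = g v := by
  have hv : f.quotKerEquivRange.symm ⟨f v, v, rfl⟩ = Submodule.Quotient.mk v :=
    (LinearEquiv.symm_apply_eq _).2 rfl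
  simp only [rangeEquivOfKerEq, LinearEquiv.trans_apply, hv, Submodule.quotEquivOfEq_mk]
  rfl

end RangeEquiv

section InnerCovector

variable {V : Type*} [NormedAddCommGroup V] [NormedSpace ℝ V] {S : Set V}
  {A : Type*} [NormedAddCommGroup A] [NormedSpace ℝ A] [ChartedSpace A S]

/-- The restriction of `⟨v, ·⟩` to the tangent space at a point of a submanifold, as a linear
function of `v`. -/
def innerCovector (B : V →L[ℝ] V →L[ℝ] ℝ) (A : Type*) [NormedAddCommGroup A] [NormedSpace ℝ A]
    [ChartedSpace A S] (s : S) : V →ₗ[ℝ] (TangentSpace 𝓘(ℝ, A) s →L[ℝ] ℝ) where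
  toFun v := (B v).comp (tangentIncl S 𝓘(ℝ, A) s)
  map_add' v v' := by rw [map_add, ContinuousLinearMap.add_comp]
  map_smul' r v := by rw [map_smul, ContinuousLinearMap.smul_comp, RingHom.id_apply]

theorem innerCovector_apply (B : V →L[ℝ] V →L[ℝ] ℝ) (s : S) (v : V)
    (a : TangentSpace 𝓘(ℝ, A) s) :
    innerCovector B A s v a = B v (tangentIncl S 𝓘(ℝ, A) s a) := rfl

theorem surjective_innerCovector [IsManifold 𝓘(ℝ, A) ∞ S] [FiniteDimensional ℝ V]
    {c : S → GraphChart A S} (hc : IsGraphAtlas c) {G : Type*} [Group G]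
    {ρ : G →* (V →L[ℝ] V)} {B : V →L[ℝ] V →L[ℝ] ℝ} (hB : IsInvariantInner ρ B) (s : S) :
    Function.Surjective (innerCovector B A s) := by
  intro p
  let p' : A →L[ℝ] ℝ := p
  refine ⟨hB.toDual.symm (p'.comp (c s).proj), ContinuousLinearMap.ext fun a => ?_⟩
  rw [innerCovector_apply, hB.apply_toDual_symm]
  exact congrArg p' (hc.proj_tangentIncl s a)

end InnerCovector

section Fiber

variable {E : Type*} [NormedAddCommGroup E] [NormedSpace ℝ E]
  {G : Type*} [Group G] [TopologicalSpace G] [ChartedSpace E G]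
  {V : Type*} [NormedAddCommGroup V] [NormedSpace ℝ V]
  {ρ : G →* (V →L[ℝ] V)} {B : V →L[ℝ] V →L[ℝ] ℝ}
  {A : Type*} [NormedAddCommGroup A] [NormedSpace ℝ A] {x : V}
  [ChartedSpace A (repOrbit ρ x)]

theorem orbitFiber_subset_semidirectOrbit [LieGroup 𝓘(ℝ, E) ∞ G] [FiniteDimensional ℝ V]
    (hρ : ContMDiff 𝓘(ℝ, E) 𝓘(ℝ, V →L[ℝ] V) ∞ ρ) (hB : IsInvariantInner ρ B) (w : repOrbit ρ x) :
    orbitFiber (E := E) ρ B w.1 ⊆ semidirectOrbit E ρ B x := by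
  rintro _ ⟨_, ⟨v, rfl⟩, rfl⟩
  exact (mem_semidirectOrbit_iff hρ hB x _).2 ⟨w.1, w.2, v, rfl⟩

variable [IsManifold 𝓘(ℝ, A) ∞ (repOrbit ρ x)] {c : repOrbit ρ x → GraphChart A (repOrbit ρ x)}

theorem tangentIncl_proj_infAct (hc : IsGraphAtlas c)
    (hρ : ContMDiff 𝓘(ℝ, E) 𝓘(ℝ, V →L[ℝ] V) ∞ ρ) (w : repOrbit ρ x) (X : E) :
    tangentIncl (repOrbit ρ x) 𝓘(ℝ, A) w ((c w).proj (infAct E ρ w.1 X)) = infAct E ρ w.1 X := by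
  refine (hc.tangentIncl_eq_fderiv_sec (hc.mem_dom w) _).trans ?_
  refine (congrArg (fderiv ℝ (c w).sec _) (hc.proj_tangentIncl w _)).trans ?_
  exact (DFunLike.congr_fun (infAct_eq_fderiv_sec_comp hρ (c w) w.2 (hc.mem_dom w)) X).symm

variable [FiniteDimensional ℝ V] [LieGroup 𝓘(ℝ, E) ∞ G] [FiniteDimensional ℝ A]

theorem ker_momentMap (hc : IsGraphAtlas c) (hρ : ContMDiff 𝓘(ℝ, E) 𝓘(ℝ, V →L[ℝ] V) ∞ ρ)
    (hB : IsInvariantInner ρ B)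
    (hA : Module.finrank ℝ (infAct E ρ x).range = Module.finrank ℝ A) (w : repOrbit ρ x) :
    (momentMap (E := E) ρ B w.1).ker = (innerCovector B A w).ker := by
  have hmoment : ∀ (v : V) (X : E), (momentMap (E := E) ρ B w.1 v : E →L[ℝ] ℝ) X =
      innerCovector B A w v ((c w).proj (infAct E ρ w.1 X)) := fun v X => by
    refine (momentMap_apply hρ w.1 v X).trans ((hB.symm _ _).trans ?_)
    exact (congrArg (B v) (tangentIncl_proj_infAct hc hρ w X)).symm
  ext v
  rw [LinearMap.mem_ker, LinearMap.mem_ker]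
  constructor <;> intro hv
  · refine ContinuousLinearMap.ext fun a => ?_
    obtain ⟨X, rfl⟩ := surjective_proj_comp_infAct hρ hA (c w) w.2 (hc.mem_dom w) a
    exact (hmoment v X).symm.trans (DFunLike.congr_fun hv X)
  · exact ContinuousLinearMap.ext fun X => (hmoment v X).trans (DFunLike.congr_fun hv _)

/-- The linear isomorphism `μ_w(v) ↦ ⟨v, ·⟩` from `μ_w(V)` to the cotangent space at `w`. -/
def fiberEquiv (hc : IsGraphAtlas c) (hρ : ContMDiff 𝓘(ℝ, E) 𝓘(ℝ, V →L[ℝ] V) ∞ ρ)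
    (hB : IsInvariantInner ρ B)
    (hA : Module.finrank ℝ (infAct E ρ x).range = Module.finrank ℝ A) (w : repOrbit ρ x) :
    (momentMap (E := E) ρ B w.1).range ≃ₗ[ℝ] (TangentSpace 𝓘(ℝ, A) w →L[ℝ] ℝ) :=
  rangeEquivOfKerEq _ _ (ker_momentMap hc hρ hB hA w) (surjective_innerCovector hc hB w)

theorem fiberEquiv_momentMap (hc : IsGraphAtlas c)
    (hρ : ContMDiff 𝓘(ℝ, E) 𝓘(ℝ, V →L[ℝ] V) ∞ ρ) (hB : IsInvariantInner ρ B)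
    (hA : Module.finrank ℝ (infAct E ρ x).range = Module.finrank ℝ A) (w : repOrbit ρ x) (v : V) :
    fiberEquiv hc hρ hB hA w ⟨momentMap ρ B w.1 v, v, rfl⟩ = innerCovector B A w v :=
  rangeEquivOfKerEq_apply _ _ _ _ v

end Fiber

/-! ### The diffeomorphism with the cotangent bundle -/

section CotangentFunctional

variable {E : Type*} [NormedAddCommGroup E] [NormedSpace ℝ E]
  {G : Type*} [Group G] [TopologicalSpace G] [ChartedSpace E G]
  {V : Type*} [NormedAddCommGroup V] [NormedSpace ℝ V]
  {ρ : G →* (V →L[ℝ] V)} {B : V →L[ℝ] V →L[ℝ] ℝ}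
  {A : Type*} [NormedAddCommGroup A] [NormedSpace ℝ A] {x : V}
  [ChartedSpace A (repOrbit ρ x)]

variable (E B) in
/-- The functional `(X, u) ↦ γ(ρ(X) w) + ⟨w, u⟩` attached to a covector `γ` at a point `w` of the
orbit. -/
def cotangentFunctional (c : repOrbit ρ x → GraphChart A (repOrbit ρ x))
    (γ : CotangentBundle 𝓘(ℝ, A) (repOrbit ρ x)) : E × V →L[ℝ] ℝ :=
  fiberPoint E B (c γ.proj) ((c γ.proj).proj γ.proj.1, γ.snd)

variable {c : repOrbit ρ x → GraphChart A (repOrbit ρ x)}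

theorem cotangentFunctional_apply (hc : IsGraphAtlas c)
    (γ : CotangentBundle 𝓘(ℝ, A) (repOrbit ρ x)) (Z : E × V) :
    cotangentFunctional E B c γ Z =
      (γ.snd : A →L[ℝ] ℝ) ((c γ.proj).proj (infAct E ρ γ.proj.1 Z.1)) + B γ.proj.1 Z.2 := by
  rw [cotangentFunctional, fiberPoint_apply, (c γ.proj).sec_proj γ.proj.2 (hc.mem_dom γ.proj)]
  rfl

theorem basePoint_cotangentFunctional [FiniteDimensional ℝ V] (hc : IsGraphAtlas c)
    (hB : IsInvariantInner ρ B) (γ : CotangentBundle 𝓘(ℝ, A) (repOrbit ρ x)) :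
    hB.basePoint E (cotangentFunctional E B c γ) = γ.proj.1 :=
  (basePoint_fiberPoint hB _ _).trans ((c γ.proj).sec_proj γ.proj.2 (hc.mem_dom γ.proj))

theorem cotangentFunctional_mem_semidirectOrbit [FiniteDimensional ℝ V]
    [LieGroup 𝓘(ℝ, E) ∞ G] (hc : IsGraphAtlas c)
    (hρ : ContMDiff 𝓘(ℝ, E) 𝓘(ℝ, V →L[ℝ] V) ∞ ρ) (hB : IsInvariantInner ρ B)
    (γ : CotangentBundle 𝓘(ℝ, A) (repOrbit ρ x)) :
    cotangentFunctional E B c γ ∈ semidirectOrbit E ρ B x :=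
  fiberPoint_mem_semidirectOrbit hρ hB _
    ((c γ.proj).proj_mem_param γ.proj.2 (hc.mem_dom γ.proj))

theorem injective_cotangentFunctional [FiniteDimensional ℝ V] [LieGroup 𝓘(ℝ, E) ∞ G]
    [FiniteDimensional ℝ A] (hc : IsGraphAtlas c)
    (hρ : ContMDiff 𝓘(ℝ, E) 𝓘(ℝ, V →L[ℝ] V) ∞ ρ) (hB : IsInvariantInner ρ B)
    (hA : Module.finrank ℝ (infAct E ρ x).range = Module.finrank ℝ A) :
    Function.Injective (cotangentFunctional E B c) := by
  rintro ⟨w, p⟩ ⟨w', p'⟩ h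
  obtain rfl : w = w' := by
    have hbase := congrArg (hB.basePoint E) h
    rw [basePoint_cotangentFunctional hc, basePoint_cotangentFunctional hc] at hbase
    exact Subtype.ext hbase
  refine congrArg _ (ContinuousLinearMap.ext fun a => ?_)
  obtain ⟨X, rfl⟩ := surjective_proj_comp_infAct hρ hA (c w) w.2 (hc.mem_dom w) a
  have hX := DFunLike.congr_fun h (X, (0 : V))
  rw [cotangentFunctional_apply hc, cotangentFunctional_apply hc] at hX
  exact add_right_cancel hX

variable [IsManifold 𝓘(ℝ, A) ∞ (repOrbit ρ x)]

theorem cotangentFunctional_innerCovector (hc : IsGraphAtlas c)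
    (hρ : ContMDiff 𝓘(ℝ, E) 𝓘(ℝ, V →L[ℝ] V) ∞ ρ) (hB : IsInvariantInner ρ B)
    (w : repOrbit ρ x) (v : V) :
    cotangentFunctional E B c ⟨w, innerCovector B A w v⟩ =
      dualPoint (E := E) ρ B w.1 (momentMap ρ B w.1 v) := by
  refine ContinuousLinearMap.ext fun Z =>
    (cotangentFunctional_apply hc _ Z).trans
      (Eq.trans ?_ (dualPoint_apply (E := E) (ρ := ρ) B w.1 _ Z).symm)
  refine congrArg (· + B w.1 Z.2) (Eq.trans ?_ (momentMap_apply hρ _ _ _).symm)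
  refine (congrArg (B v) (tangentIncl_proj_infAct hc hρ w Z.1)).trans ?_
  rw [hB.symm]

theorem fiberPoint_extChartAt (hc : IsGraphAtlas c)
    (hρ : ContMDiff 𝓘(ℝ, E) 𝓘(ℝ, V →L[ℝ] V) ∞ ρ) {γ₀ γ : CotangentBundle 𝓘(ℝ, A) (repOrbit ρ x)}
    (hγ : γ ∈ (extChartAt (cotangentModel 𝓘(ℝ, A)) γ₀).source) :
    fiberPoint E B (c γ₀.proj) (extChartAt (cotangentModel 𝓘(ℝ, A)) γ₀ γ) =
      cotangentFunctional E B c γ := by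
  rw [mem_extChartAt_cotangent_source] at hγ
  have hγc : γ.proj.1 ∈ (c γ₀.proj).dom := by rwa [hc γ₀.proj] at hγ
  have hparam : (extChartAt (cotangentModel 𝓘(ℝ, A)) γ₀ γ).1 = (c γ₀.proj).proj γ.proj.1 :=
    (congrArg Prod.fst (extChartAt_cotangent_apply γ₀ γ)).trans
      (hc.extChartAt_apply γ₀.proj γ.proj)
  refine ContinuousLinearMap.ext fun Z => ?_
  rw [cotangentFunctional_apply hc, fiberPoint_apply, hparam,
    (c γ₀.proj).sec_proj γ.proj.2 hγc]
  refine congrArg (· + B γ.proj.1 Z.2) (Eq.trans ?_ (cotangent_snd_apply γ₀ γ hγ _).symm)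
  refine congrArg (extChartAt (cotangentModel 𝓘(ℝ, A)) γ₀ γ).2
    (Eq.trans ?_ (hc.mfderiv_extChartAt γ₀.proj γ.proj _).symm)
  rw [tangentIncl_proj_infAct hc hρ]

theorem cotangentFunctional_extChartAt_symm (hc : IsGraphAtlas c)
    (hρ : ContMDiff 𝓘(ℝ, E) 𝓘(ℝ, V →L[ℝ] V) ∞ ρ) (γ₀ : CotangentBundle 𝓘(ℝ, A) (repOrbit ρ x))
    {y : A × (A →L[ℝ] ℝ)} (hy : y.1 ∈ (c γ₀.proj).param) :
    cotangentFunctional E B c ((extChartAt (cotangentModel 𝓘(ℝ, A)) γ₀).symm y) =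
      fiberPoint E B (c γ₀.proj) y := by
  have hy' := (hc.mem_extChartAt_cotangent_target_iff γ₀ y).2 hy
  rw [← fiberPoint_extChartAt hc hρ ((extChartAt _ γ₀).map_target hy'),
    (extChartAt _ γ₀).right_inv hy']

theorem cotangentFunctional_eventuallyEq (hc : IsGraphAtlas c)
    (hρ : ContMDiff 𝓘(ℝ, E) 𝓘(ℝ, V →L[ℝ] V) ∞ ρ) (γ : CotangentBundle 𝓘(ℝ, A) (repOrbit ρ x)) :
    cotangentFunctional E B c =ᶠ[𝓝 γ]
      fiberPoint E B (c γ.proj) ∘ extChartAt (cotangentModel 𝓘(ℝ, A)) γ := by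
  filter_upwards [extChartAt_source_mem_nhds (I := cotangentModel 𝓘(ℝ, A)) γ] with γ' hγ'
  exact (fiberPoint_extChartAt hc hρ hγ').symm

theorem contMDiff_cotangentFunctional (hc : IsGraphAtlas c)
    (hρ : ContMDiff 𝓘(ℝ, E) 𝓘(ℝ, V →L[ℝ] V) ∞ ρ) :
    ContMDiff (cotangentModel 𝓘(ℝ, A)) 𝓘(ℝ, E × V →L[ℝ] ℝ) ∞ (cotangentFunctional E B c) := by
  intro γ
  have hfiberPoint : ContMDiffAt 𝓘(ℝ, A × (A →L[ℝ] ℝ)) 𝓘(ℝ, E × V →L[ℝ] ℝ) ∞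
      (fiberPoint E B (c γ.proj)) (extChartAt (cotangentModel 𝓘(ℝ, A)) γ γ) :=
    ((contDiffOn_fiberPoint (E := E) (B := B) (c γ.proj)).contDiffAt
      (((c γ.proj).isOpen_param.prod isOpen_univ).mem_nhds
        ⟨hc.extChartAt_cotangent_self_fst_mem_param γ, trivial⟩)).contMDiffAt
  have hchart : ContMDiffAt (cotangentModel 𝓘(ℝ, A)) 𝓘(ℝ, A × (A →L[ℝ] ℝ)) ∞
      (extChartAt (cotangentModel 𝓘(ℝ, A)) γ) γ := contMDiffAt_extChartAt
  exact (hfiberPoint.comp γ hchart).congr_of_eventuallyEq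
    (cotangentFunctional_eventuallyEq hc hρ γ)

theorem exists_cotangentFunctional_eq [LieGroup 𝓘(ℝ, E) ∞ G] (hc : IsGraphAtlas c)
    (hρ : ContMDiff 𝓘(ℝ, E) 𝓘(ℝ, V →L[ℝ] V) ∞ ρ) (hB : IsInvariantInner ρ B)
    {ξ : E × V →L[ℝ] ℝ} (hξ : ξ ∈ semidirectOrbit E ρ B x) :
    ∃ γ, cotangentFunctional E B c γ = ξ := by
  obtain ⟨w, hw, v, rfl⟩ := (mem_semidirectOrbit_iff hρ hB x ξ).1 hξ
  exact ⟨_, cotangentFunctional_innerCovector hc hρ hB ⟨w, hw⟩ v⟩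

end CotangentFunctional

section OrbitDiffeomorph

variable {E : Type*} [NormedAddCommGroup E] [NormedSpace ℝ E]
  {G : Type*} [Group G] [TopologicalSpace G] [ChartedSpace E G] [LieGroup 𝓘(ℝ, E) ∞ G]
  {V : Type*} [NormedAddCommGroup V] [NormedSpace ℝ V] [FiniteDimensional ℝ V]
  {ρ : G →* (V →L[ℝ] V)} {B : V →L[ℝ] V →L[ℝ] ℝ}
  {A : Type*} [NormedAddCommGroup A] [NormedSpace ℝ A] [FiniteDimensional ℝ A] {x : V}
  [ChartedSpace A (repOrbit ρ x)] [IsManifold 𝓘(ℝ, A) ∞ (repOrbit ρ x)]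
  {c : repOrbit ρ x → GraphChart A (repOrbit ρ x)}

/-- The bijection from the coadjoint orbit to the cotangent bundle of the orbit of the
representation, inverse to `cotangentFunctional`. -/
def orbitEquiv (hc : IsGraphAtlas c) (hρ : ContMDiff 𝓘(ℝ, E) 𝓘(ℝ, V →L[ℝ] V) ∞ ρ)
    (hB : IsInvariantInner ρ B)
    (hA : Module.finrank ℝ (infAct E ρ x).range = Module.finrank ℝ A) :
    semidirectOrbit E ρ B x ≃ CotangentBundle 𝓘(ℝ, A) (repOrbit ρ x) :=
  (Equiv.ofBijective
    (Set.codRestrict (cotangentFunctional E B c) (semidirectOrbit E ρ B x)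
      (cotangentFunctional_mem_semidirectOrbit hc hρ hB))
    ⟨(injective_cotangentFunctional hc hρ hB hA).codRestrict _,
      fun ξ => (exists_cotangentFunctional_eq hc hρ hB ξ.2).imp fun _ => Subtype.ext⟩).symm

variable (hc : IsGraphAtlas c) (hρ : ContMDiff 𝓘(ℝ, E) 𝓘(ℝ, V →L[ℝ] V) ∞ ρ)
  (hB : IsInvariantInner ρ B) (hA : Module.finrank ℝ (infAct E ρ x).range = Module.finrank ℝ A)

theorem cotangentFunctional_orbitEquiv (ξ : semidirectOrbit E ρ B x) :
    cotangentFunctional E B c (orbitEquiv hc hρ hB hA ξ) = ξ.1 :=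
  congrArg Subtype.val ((orbitEquiv hc hρ hB hA).symm_apply_apply ξ)

theorem orbitEquiv_eq {ξ : semidirectOrbit E ρ B x}
    {γ : CotangentBundle 𝓘(ℝ, A) (repOrbit ρ x)} (h : cotangentFunctional E B c γ = ξ.1) :
    orbitEquiv hc hρ hB hA ξ = γ :=
  (Equiv.eq_symm_apply _).1 (Subtype.ext h.symm)

theorem orbitEquiv_eq_fiberEquiv (w : repOrbit ρ x) (ξ : semidirectOrbit E ρ B x)
    (α : (momentMap (E := E) ρ B w.1).range) (hξ : ξ.1 = dualPoint ρ B w.1 α.1) :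
    orbitEquiv hc hρ hB hA ξ = ⟨w, fiberEquiv hc hρ hB hA w α⟩ := by
  obtain ⟨_, v, rfl⟩ := α
  rw [fiberEquiv_momentMap]
  exact orbitEquiv_eq hc hρ hB hA ((cotangentFunctional_innerCovector hc hρ hB w v).trans hξ.symm)

theorem image_orbitEquiv_orbitFiber (w : repOrbit ρ x) :
    orbitEquiv hc hρ hB hA '' (Subtype.val ⁻¹' orbitFiber (E := E) ρ B w.1) =
      {γ | γ.proj = w} := by
  refine Set.Subset.antisymm ?_ ?_
  · rintro _ ⟨ξ, ⟨α, hα, hξ⟩, rfl⟩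
    exact congrArg (fun γ => γ.proj) (orbitEquiv_eq_fiberEquiv hc hρ hB hA w ξ ⟨α, hα⟩ hξ.symm)
  · rintro ⟨w, p⟩ rfl
    obtain ⟨α, rfl⟩ := (fiberEquiv hc hρ hB hA w).surjective p
    have hα : dualPoint ρ B w.1 α.1 ∈ orbitFiber (E := E) ρ B w.1 := ⟨α.1, α.2, rfl⟩
    exact ⟨⟨_, orbitFiber_subset_semidirectOrbit hρ hB w hα⟩, hα,
      orbitEquiv_eq_fiberEquiv hc hρ hB hA w _ α rfl⟩

variable {A' : Type*} [NormedAddCommGroup A'] [NormedSpace ℝ A']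
  [ChartedSpace A' (semidirectOrbit E ρ B x)]
  {d : semidirectOrbit E ρ B x → GraphChart A' (semidirectOrbit E ρ B x)}

theorem contMDiff_orbitEquiv_symm (hd : IsGraphAtlas d) :
    ContMDiff (cotangentModel 𝓘(ℝ, A)) 𝓘(ℝ, A') ∞ (orbitEquiv hc hρ hB hA).symm := by
  have hsmooth := contMDiff_cotangentFunctional (B := B) hc hρ
  intro γ
  refine contMDiffAt_iff_target.2 ⟨(hsmooth.continuous.codRestrict
    (cotangentFunctional_mem_semidirectOrbit hc hρ hB)).continuousAt, ?_⟩
  refine (((d ((orbitEquiv hc hρ hB hA).symm γ)).proj.contMDiff.comp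
    hsmooth) γ).congr_of_eventuallyEq (Filter.Eventually.of_forall fun γ' => ?_)
  exact hd.extChartAt_apply _ _

theorem contMDiff_orbitEquiv (hd : IsGraphAtlas d) :
    ContMDiff 𝓘(ℝ, A') (cotangentModel 𝓘(ℝ, A)) ∞ (orbitEquiv hc hρ hB hA) := by
  intro ξ
  let γ := orbitEquiv hc hρ hB hA ξ
  let e := extChartAt (cotangentModel 𝓘(ℝ, A)) γ
  have hbase : hB.basePoint E ξ.1 = γ.proj.1 := by
    rw [← basePoint_cotangentFunctional (E := E) hc hB γ,
      cotangentFunctional_orbitEquiv hc hρ hB hA ξ]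
  obtain ⟨κ, hκsmooth, hκ⟩ := exists_contDiffAt_fiberPoint_eq hρ hB hA (c γ.proj) ξ.2
    (hbase ▸ hc.mem_dom γ.proj)
  have htarget : κ ξ.1 ∈ e.target :=
    (hc.mem_extChartAt_cotangent_target_iff γ _).2 (hκ.self_of_nhds ξ.2).1
  have he : ContMDiffAt 𝓘(ℝ, A × (A →L[ℝ] ℝ)) (cotangentModel 𝓘(ℝ, A)) ∞ e.symm (κ ξ.1) :=
    (contMDiffOn_extChartAt_symm γ).contMDiffAt ((isOpen_extChartAt_target γ).mem_nhds htarget)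
  have hcoord : ContMDiffAt 𝓘(ℝ, A') 𝓘(ℝ, A × (A →L[ℝ] ℝ)) ∞
      (fun η : semidirectOrbit E ρ B x => κ η.1) ξ :=
    hκsmooth.contMDiffAt.comp ξ (hd.contMDiff_val ξ)
  refine (he.comp ξ hcoord).congr_of_eventuallyEq ?_
  filter_upwards [continuous_subtype_val.continuousAt.eventually hκ] with η hη
  obtain ⟨hparam, hfiber⟩ := hη η.2
  exact orbitEquiv_eq hc hρ hB hA
    ((cotangentFunctional_extChartAt_symm hc hρ γ hparam).trans hfiber)

/-- The bijection `orbitEquiv` as a diffeomorphism. -/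
def orbitDiffeomorph (hd : IsGraphAtlas d) :
    Diffeomorph 𝓘(ℝ, A') (cotangentModel 𝓘(ℝ, A)) (semidirectOrbit E ρ B x)
      (CotangentBundle 𝓘(ℝ, A) (repOrbit ρ x)) ∞ where
  toEquiv := orbitEquiv hc hρ hB hA
  contMDiff_toFun := contMDiff_orbitEquiv hc hρ hB hA hd
  contMDiff_invFun := contMDiff_orbitEquiv_symm hc hρ hB hA hd

end OrbitDiffeomorph

section CanonicalForm

variable {E : Type*} [NormedAddCommGroup E] [NormedSpace ℝ E]
  {G : Type*} [Group G] [TopologicalSpace G] [ChartedSpace E G]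
  {V : Type*} [NormedAddCommGroup V] [NormedSpace ℝ V]
  {ρ : G →* (V →L[ℝ] V)} {B : V →L[ℝ] V →L[ℝ] ℝ}
  {A : Type*} [NormedAddCommGroup A] [NormedSpace ℝ A] {x : V}
  [ChartedSpace A (repOrbit ρ x)] [IsManifold 𝓘(ℝ, A) ∞ (repOrbit ρ x)]
  {c : repOrbit ρ x → GraphChart A (repOrbit ρ x)}
  {A' : Type*} [NormedAddCommGroup A'] [NormedSpace ℝ A']
  [ChartedSpace A' (semidirectOrbit E ρ B x)]

theorem tangentIncl_eq_fderiv_fiberPoint (hc : IsGraphAtlas c)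
    (hρ : ContMDiff 𝓘(ℝ, E) 𝓘(ℝ, V →L[ℝ] V) ∞ ρ)
    {φ : semidirectOrbit E ρ B x → CotangentBundle 𝓘(ℝ, A) (repOrbit ρ x)}
    {ξ : semidirectOrbit E ρ B x}
    (hφ : MDifferentiableAt 𝓘(ℝ, A') (cotangentModel 𝓘(ℝ, A)) φ ξ)
    (hφval : ∀ η, cotangentFunctional E B c (φ η) = η.1) (a : TangentSpace 𝓘(ℝ, A') ξ) :
    tangentIncl (semidirectOrbit E ρ B x) 𝓘(ℝ, A') ξ a =
      fderiv ℝ (fiberPoint E B (c (φ ξ).proj)) (extChartAt (cotangentModel 𝓘(ℝ, A)) (φ ξ) (φ ξ))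
        (mfderiv (cotangentModel 𝓘(ℝ, A)) 𝓘(ℝ, A × (A →L[ℝ] ℝ))
          (extChartAt (cotangentModel 𝓘(ℝ, A)) (φ ξ)) (φ ξ)
          (mfderiv 𝓘(ℝ, A') (cotangentModel 𝓘(ℝ, A)) φ ξ a)) := by
  have hchart : HasMFDerivAt (cotangentModel 𝓘(ℝ, A)) 𝓘(ℝ, A × (A →L[ℝ] ℝ))
      (extChartAt (cotangentModel 𝓘(ℝ, A)) (φ ξ)) (φ ξ) _ :=
    (mdifferentiableAt_extChartAt (I := cotangentModel 𝓘(ℝ, A))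
      (mem_chart_source _ (φ ξ))).hasMFDerivAt
  have hfiberPoint := (hasFDerivAt_fiberPoint (E := E) (B := B) (c (φ ξ).proj)
    (hc.extChartAt_cotangent_self_fst_mem_param (φ ξ))).hasMFDerivAt
  have hval : (Subtype.val : semidirectOrbit E ρ B x → E × V →L[ℝ] ℝ) =ᶠ[𝓝 ξ]
      fiberPoint E B (c (φ ξ).proj) ∘ extChartAt (cotangentModel 𝓘(ℝ, A)) (φ ξ) ∘ φ := by
    filter_upwards [hφ.continuousAt.eventually
      (cotangentFunctional_eventuallyEq (B := B) hc hρ (φ ξ))] with η hη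
    exact (hφval η).symm.trans hη
  exact DFunLike.congr_fun ((hfiberPoint.comp ξ
    (hchart.comp ξ hφ.hasMFDerivAt)).congr_of_eventuallyEq hval).mfderiv a

theorem canonicalForm_eq_kksForm [FiniteDimensional ℝ E] [LieGroup 𝓘(ℝ, E) ∞ G]
    [FiniteDimensional ℝ V] [FiniteDimensional ℝ A] (hc : IsGraphAtlas c)
    (hρ : ContMDiff 𝓘(ℝ, E) 𝓘(ℝ, V →L[ℝ] V) ∞ ρ) (hB : IsInvariantInner ρ B)
    (hA : Module.finrank ℝ (infAct E ρ x).range = Module.finrank ℝ A)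
    {φ : semidirectOrbit E ρ B x → CotangentBundle 𝓘(ℝ, A) (repOrbit ρ x)}
    {ξ : semidirectOrbit E ρ B x}
    (hφ : MDifferentiableAt 𝓘(ℝ, A') (cotangentModel 𝓘(ℝ, A)) φ ξ)
    (hφval : ∀ η, cotangentFunctional E B c (φ η) = η.1) (a b : TangentSpace 𝓘(ℝ, A') ξ) :
    canonicalForm 𝓘(ℝ, A) (repOrbit ρ x) (φ ξ)
        (mfderiv 𝓘(ℝ, A') (cotangentModel 𝓘(ℝ, A)) φ ξ a)
        (mfderiv 𝓘(ℝ, A') (cotangentModel 𝓘(ℝ, A)) φ ξ b) =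
      kksForm (semidirectModel E V) (SemidirectGroup ρ) (semidirectOrbit E ρ B x) 𝓘(ℝ, A')
        ξ a b := by
  have hξ : fiberPoint E B (c (φ ξ).proj)
      (extChartAt (cotangentModel 𝓘(ℝ, A)) (φ ξ) (φ ξ)) = ξ.1 :=
    (fiberPoint_extChartAt hc hρ (mem_extChartAt_source (φ ξ))).trans (hφval ξ)
  have hcoord (v : TangentSpace 𝓘(ℝ, A') ξ) : ∃ v' : A × (A →L[ℝ] ℝ),
      mfderiv (cotangentModel 𝓘(ℝ, A)) 𝓘(ℝ, A × (A →L[ℝ] ℝ))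
          (extChartAt (cotangentModel 𝓘(ℝ, A)) (φ ξ)) (φ ξ)
          (mfderiv 𝓘(ℝ, A') (cotangentModel 𝓘(ℝ, A)) φ ξ v) = v' ∧
        fderiv ℝ (fiberPoint E B (c (φ ξ).proj))
          (extChartAt (cotangentModel 𝓘(ℝ, A)) (φ ξ) (φ ξ)) v' =
        tangentIncl (semidirectOrbit E ρ B x) 𝓘(ℝ, A') ξ v :=
    ⟨_, rfl, (tangentIncl_eq_fderiv_fiberPoint hc hρ hφ hφval v).symm⟩
  obtain ⟨a', ha', ha⟩ := hcoord a
  obtain ⟨b', hb', hb⟩ := hcoord b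
  obtain ⟨X, Y, hX, hY, hXY⟩ := exists_fiberPoint_semidirectBracket_eq hρ hB hA (c (φ ξ).proj)
    (hc.extChartAt_cotangent_self_fst_mem_param (φ ξ)) a' b'
  rw [hξ, ha] at hX
  rw [hξ, hb] at hY
  rw [hξ] at hXY
  rw [canonicalForm_eq (φ ξ) _ _ a' b' ha' hb',
    kksForm_eq (semidirectModel E V) (SemidirectGroup ρ) (semidirectOrbit E ρ B x) 𝓘(ℝ, A')
      ξ a b X Y hX hY]
  exact hXY.symm

end CanonicalForm

end SemidirectOrbit

end

open SemidirectOrbit in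
theorem mainTheorem5
    {E : Type*} [NormedAddCommGroup E] [NormedSpace ℝ E] [FiniteDimensional ℝ E]
    {G : Type*} [Group G] [TopologicalSpace G] [ChartedSpace E G] [LieGroup 𝓘(ℝ, E) ∞ G]
    [CompactSpace G]
    {V : Type*} [NormedAddCommGroup V] [NormedSpace ℝ V] [FiniteDimensional ℝ V]
    (ρ : G →* (V →L[ℝ] V)) (hρ : ContMDiff 𝓘(ℝ, E) 𝓘(ℝ, V →L[ℝ] V) ∞ ρ) :
    (∃ B : V →L[ℝ] V →L[ℝ] ℝ, IsInvariantInner ρ B) ∧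
    ∀ B : V →L[ℝ] V →L[ℝ] ℝ, IsInvariantInner ρ B → ∀ x : V,
      -- both orbits are embedded submanifolds
      ∃ (m k : ℕ)
        (_ : ChartedSpace (EuclideanSpace ℝ (Fin m)) (repOrbit ρ x))
        (_ : IsManifold (𝓡 m) ∞ (repOrbit ρ x))
        (_ : Manifold.IsSmoothEmbedding (𝓡 m) 𝓘(ℝ, V) ∞ (Subtype.val : repOrbit ρ x → V))
        (_ : ChartedSpace (EuclideanSpace ℝ (Fin k)) (semidirectOrbit E ρ B x))
        (_ : IsManifold (𝓡 k) ∞ (semidirectOrbit E ρ B x))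
        (_ : Manifold.IsSmoothEmbedding (𝓡 k)
          𝓘(ℝ, DualLieAlgebra (semidirectModel E V) (SemidirectGroup ρ)) ∞
          (Subtype.val : semidirectOrbit E ρ B x → _))
        -- a diffeomorphism onto the cotangent bundle
        (φ : Diffeomorph (𝓡 k) (cotangentModel (𝓡 m)) (semidirectOrbit E ρ B x)
          (CotangentBundle (𝓡 m) (repOrbit ρ x)) ∞)
        (ℓ : ∀ w : repOrbit ρ x, LinearMap.range (momentMap (E := E) ρ B w.1) ≃ₗ[ℝ]
          (TangentSpace (𝓡 m) w →L[ℝ] ℝ)),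
        -- it maps the fibre `w + μ_w(V)` onto `T_w^*`
        (∀ w : repOrbit ρ x, orbitFiber (E := E) ρ B w.1 ⊆ semidirectOrbit E ρ B x ∧
          φ '' (Subtype.val ⁻¹' orbitFiber ρ B w.1) = {γ | γ.proj = w}) ∧
        -- on that fibre it is the linear isomorphism `ℓ w`
        (∀ (w : repOrbit ρ x) (ξ : semidirectOrbit E ρ B x)
          (α : LinearMap.range (momentMap (E := E) ρ B w.1)),
          ξ.1 = dualPoint ρ B w.1 α.1 → φ ξ = ⟨w, ℓ w α⟩) ∧
        -- which sends `μ_w(v)` to the restriction of `⟨v, ·⟩` to the tangent space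
        (∀ (w : repOrbit ρ x) (v : V) (a : TangentSpace (𝓡 m) w),
          ℓ w ⟨momentMap ρ B w.1 v, v, rfl⟩ a = B v (tangentIncl (repOrbit ρ x) (𝓡 m) w a)) ∧
        -- `φ^* ω = Ω`
        (∀ (ξ : semidirectOrbit E ρ B x) (a b : TangentSpace (𝓡 k) ξ),
          canonicalForm (𝓡 m) (repOrbit ρ x) (φ ξ)
            (mfderiv (𝓡 k) (cotangentModel (𝓡 m)) φ ξ a)
            (mfderiv (𝓡 k) (cotangentModel (𝓡 m)) φ ξ b) =
          kksForm (semidirectModel E V) (SemidirectGroup ρ) (semidirectOrbit E ρ B x) (𝓡 k) ξ a b) := by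
  have : IsTopologicalGroup G := topologicalGroup_of_lieGroup 𝓘(ℝ, E) ∞
  refine ⟨exists_isInvariantInner ρ hρ.continuous, fun B hB x => ?_⟩
  let A := EuclideanSpace ℝ (Fin (Module.finrank ℝ (infAct E ρ x).range))
  have hA : Module.finrank ℝ (infAct E ρ x).range = Module.finrank ℝ A :=
    finrank_euclideanSpace_fin.symm
  let K : (A × (A →L[ℝ] ℝ)) ≃L[ℝ] EuclideanSpace ℝ (Fin (Module.finrank ℝ (A × (A →L[ℝ] ℝ)))) :=
    .ofFinrankEq finrank_euclideanSpace_fin.symm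
  choose c hc using exists_graphChart_repOrbit (A := A) hρ x hA
  choose d hd using fun ξ : semidirectOrbit E ρ B x =>
    exists_graphChart_semidirectOrbit hρ hB hA K (c ⟨_, basePoint_mem_repOrbit hρ hB ξ.2⟩) ξ.2
      (hc _)
  let _ := graphChartedSpace c hc
  let _ := graphChartedSpace d hd
  have hM := isManifold_graphChartedSpace c hc
  have hO := isManifold_graphChartedSpace d hd
  have hcatlas : IsGraphAtlas c := fun _ => rfl
  have hdatlas : IsGraphAtlas d := fun _ => rfl
  let φ := orbitDiffeomorph hcatlas hρ hB hA hdatlas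
  exact ⟨_, _, inferInstance, hM, hcatlas.isSmoothEmbedding_val, inferInstance, hO,
    hdatlas.isSmoothEmbedding_val, φ, fiberEquiv hcatlas hρ hB hA,
    fun w => ⟨orbitFiber_subset_semidirectOrbit hρ hB w,
      image_orbitEquiv_orbitFiber hcatlas hρ hB hA w⟩,
    orbitEquiv_eq_fiberEquiv hcatlas hρ hB hA,
    fun w v a => DFunLike.congr_fun (fiberEquiv_momentMap hcatlas hρ hB hA w v) a,
    fun ξ a b => canonicalForm_eq_kksForm hcatlas hρ hB hA (φ.mdifferentiable (by simp) ξ)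
      (cotangentFunctional_orbitEquiv hcatlas hρ hB hA) a b⟩
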